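/- Let $Z$ be a compact (Hausdorff) abelian group with normalized Haar measure $\mu$; all functions are real valued and measurable, $\|\cdot\|_p$ is the $L^p(\mu)$ norm, and $\mathbb E$ denotes integration with respect to $\mu$ (or to its product measures). Let $d\ge 1$ be an integer. For $\vec t\in Z^d$ and $\vec\epsilon\in\{0,1\}^d$ write $\vec\epsilon\cdot\vec t=\epsilon_1t_1+\dots+\epsilon_dt_d$. For $f\in L^{2^{d-1}}(\mu)$ define the uniformity norm and the dual function of level $d$ by $$\|f\|_{U(d)}=\Bigl(\mathbb E_{x\in Z,\ \vec t\in Z^d}\prod_{\vec\epsilon\in\{0,1\}^d}f(x+\vec\epsilon\cdot\vec t)\Bigr)^{1/2^d},\qquad \mathcal D_df(x)=\mathbb E_{\vec t\in Z^d}\prod_{\vec\epsilon\in\{0,1\}^d,\ \vec\epsilon\ne\vec 0}f(x+\vec\epsilon\cdot\vec t).$$ A function $g\in L^{2^{d-1}/(2^{d-1}-1)}(\mu)$ is called anti-uniform of level $d$ if $$\|g\|_{U(d)}^*:=\sup\bigl\{\,|\mathbb E_{x\in Z}\,g(x)f(x)|\ :\ f\in L^{2^{d-1}}(\mu),\ \|f\|_{U(d)}\le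 1\bigr\}<+\infty .$$ (The exponent $2^m/(2^m-1)$ is read as $\infty$ when $m=0$.) **Theorem.** For every anti-uniform function $g$ of level $d$ with $\|g\|_{U(d)}^*=1$, every integer $k\ge d-1$ and every $\delta>0$, there exist $f\in L^{2^k}(\mu)$ and $h\in L^{2^k/(2^k-1)}(\mu)$ such that $$g=\mathcal D_df+h,\qquad \|f\|_{2^k}\le 1/\delta,\qquad \|h\|_{2^k/(2^k-1)}\le\delta,\qquad \|f\|_{U(d)}\le 1.$$ -/

import Mathlib

open MeasureTheory

noncomputable section

/-- For a vertex `ε` of the cube `{0,1}^d` and `t ∈ Z^d`, the element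
`ε · t = ε₁ t₁ + ⋯ + ε_d t_d` of `Z`. -/
def cubeDot {Z : Type*} [AddCommGroup Z] {d : ℕ} (ε : Fin d → Fin 2) (t : Fin d → Z) : Z :=
  ∑ i, (ε i : ℕ) • t i

/-- The uniformity (Gowers) norm of level `d ≥ 1`: the `2^d`-th root of
`E_{x ∈ Z, t ∈ Z^d} ∏_{ε ∈ {0,1}^d} f (x + ε · t)`. -/
def gowersNorm {Z : Type*} [AddCommGroup Z] [MeasurableSpace Z] (μ : Measure Z) (d : ℕ)
    (f : Z → ℝ) : ℝ :=
  (∫ p : Z × (Fin d → Z), ∏ ε : Fin d → Fin 2, f (p.1 + cubeDot ε p.2)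
    ∂(μ.prod (Measure.pi fun _ : Fin d => μ))) ^ (1 / (2 : ℝ) ^ d)

/-- The dual function of level `d`:
`x ↦ E_{t ∈ Z^d} ∏_{ε ∈ {0,1}^d, ε ≠ 0} f (x + ε · t)`. -/
def dualFunction {Z : Type*} [AddCommGroup Z] [MeasurableSpace Z] (μ : Measure Z) (d : ℕ)
    (f : Z → ℝ) (x : Z) : ℝ :=
  ∫ t : Fin d → Z, ∏ ε ∈ Finset.univ.erase (0 : Fin d → Fin 2), f (x + cubeDot ε t)
    ∂(Measure.pi fun _ : Fin d => μ)

/-- The conjugate exponent `2^k / (2^k - 1)` of `2^k`; it is `1 / 0 = ∞` when `k = 0`. -/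
def dyadicConj (k : ℕ) : ENNReal := (2 : ENNReal) ^ k / ((2 : ENNReal) ^ k - 1)

/-- The set of all `|⟨g ; f⟩|` with `f ∈ L^{2^{d-1}}` and `‖f‖_{U(d)} ≤ 1`. -/
def antiUniformPairings {Z : Type*} [AddCommGroup Z] [MeasurableSpace Z] (μ : Measure Z) (d : ℕ)
    (g : Z → ℝ) : Set ℝ :=
  {r | ∃ f : Z → ℝ, MemLp f ((2 : ENNReal) ^ (d - 1)) μ ∧ gowersNorm μ d f ≤ 1 ∧
    r = |∫ x, g x * f x ∂μ|}

/-- `g` is an anti-uniform function of level `d`: it lies in the Lebesgue space of exponent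
`2^{d-1} / (2^{d-1} - 1)`, and it is bounded on the unit ball of `L^{2^{d-1}}` for `U(d)`. -/
def IsAntiUniform {Z : Type*} [AddCommGroup Z] [MeasurableSpace Z] (μ : Measure Z) (d : ℕ)
    (g : Z → ℝ) : Prop :=
  MemLp g (dyadicConj (d - 1)) μ ∧ BddAbove (antiUniformPairings μ d g)

/-- The anti-uniform norm of level `d`, for an anti-uniform function `g` of level `d`. -/
def antiUniformNorm {Z : Type*} [AddCommGroup Z] [MeasurableSpace Z] (μ : Measure Z) (d : ℕ)
    (g : Z → ℝ) : ℝ :=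
  sSup (antiUniformPairings μ d g)

end

/-! For k ≥ 1, minimise over F in L^{2^k} the functional Φ(F) = 2^{-d} ‖F‖_{U(d)}^{2^d} + 2^{-k}
δ^{2^k} ‖F‖^{2^k} - ⟨g, F⟩. The bound on g gives ⟨g, F⟩ ≤ ‖F‖_{U(d)}, so Φ is bounded below. The
first term is convex by Cauchy-Schwarz-Gowers (`cubeForm_le_average`) and the second uniformly
convex by a Clarkson inequality, so a minimiser exists (`exists_forall_le_of_uniformlyConvex`). Both
terms are diagonals of continuous multilinear forms, hence differentiable, and the Euler-Lagrange
equation is g = D_d F + δ^{2^k} F^{2^k-1} (`exists_decomposition`). Pairing it with F gives a^{2^d}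
+ (δ‖F‖)^{2^k} ≤ a for a = ‖F‖_{U(d)}. Hence a ≤ 1 and δ‖F‖ ≤ 1, and the remainder has norm
δ(δ‖F‖)^{2^k-1} ≤ δ.

For k = 0 uniform convexity fails, but then d = 1, the U(1) norm is |∫ f|, and g is a constant.

When Z is not metrizable, addition need not be measurable for the product of the Borel σ-algebras.
The analysis is therefore done on the Baire σ-algebra, where it is, and transferred back. -/

noncomputable section

/-! ### Multilinear forms given by Hölder-type inequalities -/

section PullbackProduct

variable {ι Ω Z : Type*} [Fintype ι] [MeasurableSpace Ω] [MeasurableSpace Z]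
  {P : Measure Ω} {μ : Measure Z} {π : ι → Ω → Z}

/-- The product `ω ↦ ∏ i, u i (π i ω)` of the pullbacks of the functions `u i`. -/
def pullbackProd (π : ι → Ω → Z) (u : ι → Z → ℝ) (ω : Ω) : ℝ := ∏ i, u i (π i ω)

theorem pullbackProd_ae_congr (hπ : ∀ i, MeasurePreserving (π i) P μ) {u v : ι → Z → ℝ}
    (h : ∀ i, u i =ᵐ[μ] v i) : pullbackProd π u =ᵐ[P] pullbackProd π v := by
  have : ∀ᵐ ω ∂P, ∀ i, u i (π i ω) = v i (π i ω) :=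
    ae_all_iff.2 fun i => (hπ i).quasiMeasurePreserving.ae (h i)
  filter_upwards [this] with ω hω
  exact Finset.prod_congr rfl fun i _ => hω i

theorem aestronglyMeasurable_pullbackProd (hπ : ∀ i, MeasurePreserving (π i) P μ)
    {u : ι → Z → ℝ} (h : ∀ i, AEStronglyMeasurable (u i) μ) :
    AEStronglyMeasurable (pullbackProd π u) P :=
  Finset.aestronglyMeasurable_fun_prod _ fun i _ => (h i).comp_measurePreserving (hπ i)

omit [MeasurableSpace Ω] [MeasurableSpace Z] in
theorem pullbackProd_update [DecidableEq ι] (u : ι → Z → ℝ) (i : ι) (f : Z → ℝ) (ω : Ω) :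
    pullbackProd π (Function.update u i f) ω =
      f (π i ω) * ∏ j ∈ Finset.univ.erase i, u j (π j ω) := by
  unfold pullbackProd
  rw [← Finset.mul_prod_erase _ _ (Finset.mem_univ i), Function.update_self]
  congr 1
  refine Finset.prod_congr rfl fun j hj => ?_
  rw [Function.update_of_ne (Finset.ne_of_mem_erase hj)]

/-- The maps `π i` are measure preserving, and the integral of a product of pullbacks is bounded by
the product of the `L^p` norms of the factors. -/
structure IsHolderFamily (π : ι → Ω → Z) (P : Measure Ω) (μ : Measure Z) (p : ENNReal) :
    Prop where
  measurePreserving : ∀ i, MeasurePreserving (π i) P μ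
  lintegral_le : ∀ u : ι → Z → ℝ, (∀ i, AEStronglyMeasurable (u i) μ) →
    ∫⁻ ω, ‖pullbackProd π u ω‖ₑ ∂P ≤ ∏ i, eLpNorm (u i) p μ

namespace IsHolderFamily

variable {p : ENNReal} (h : IsHolderFamily π P μ p)

include h

theorem integrable {u : ι → Z → ℝ} (hu : ∀ i, MemLp (u i) p μ) :
    Integrable (pullbackProd π u) P := by
  refine ⟨aestronglyMeasurable_pullbackProd h.measurePreserving
    fun i => (hu i).aestronglyMeasurable, ?_⟩
  refine (h.lintegral_le u fun i => (hu i).aestronglyMeasurable).trans_lt ?_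
  exact ENNReal.prod_lt_top fun i _ => (hu i).eLpNorm_lt_top

theorem abs_integral_le {u : ι → Z → ℝ} (hu : ∀ i, MemLp (u i) p μ) :
    |∫ ω, pullbackProd π u ω ∂P| ≤ ∏ i, (eLpNorm (u i) p μ).toReal := by
  rw [← Real.norm_eq_abs, ← ENNReal.toReal_prod]
  refine (norm_integral_le_lintegral_norm _).trans ?_
  refine ENNReal.toReal_mono
    (ENNReal.prod_lt_top fun i _ => (hu i).eLpNorm_lt_top).ne ?_
  simpa only [ofReal_norm] using h.lintegral_le u fun i => (hu i).aestronglyMeasurable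

theorem integral_congr {u v : ι → Z → ℝ} (huv : ∀ i, u i =ᵐ[μ] v i) :
    ∫ ω, pullbackProd π u ω ∂P = ∫ ω, pullbackProd π v ω ∂P :=
  integral_congr_ae (pullbackProd_ae_congr h.measurePreserving huv)

end IsHolderFamily

omit [Fintype ι] in
theorem coeFn_update_ae [DecidableEq ι] {p : ENNReal} (m : ι → Lp ℝ p μ) (i : ι) (F : Lp ℝ p μ)
    {f : Z → ℝ} (hf : F =ᵐ[μ] f) (j : ι) :
    (Function.update m i F j : Z → ℝ) =ᵐ[μ] Function.update (fun j => (m j : Z → ℝ)) i f j := by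
  rcases eq_or_ne j i with rfl | hj
  · simpa using hf
  · simp [Function.update_of_ne hj]

/-- The continuous multilinear form `(F i) ↦ ∫ ∏ i, F i ∘ π i` on `L^p`. -/
def IsHolderFamily.form {p : ENNReal} [Fact (1 ≤ p)] (h : IsHolderFamily π P μ p) :
    ContinuousMultilinearMap ℝ (fun _ : ι => Lp ℝ p μ) ℝ :=
  MultilinearMap.mkContinuous
    { toFun := fun F => ∫ ω, pullbackProd π (fun i => (F i : Z → ℝ)) ω ∂P
      map_update_add' := by
        intro _ m i x y
        have hm : ∀ G : Lp ℝ p μ, Integrable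
            (pullbackProd π (Function.update (fun j => (m j : Z → ℝ)) i G)) P := by
          intro G
          refine h.integrable fun j => ?_
          exact (Lp.memLp (Function.update m i G j)).ae_eq (coeFn_update_ae m i G .rfl j)
        rw [h.integral_congr (coeFn_update_ae m i (x + y) (Lp.coeFn_add x y)),
          h.integral_congr (coeFn_update_ae m i x .rfl),
          h.integral_congr (coeFn_update_ae m i y .rfl), ← integral_add (hm x) (hm y)]
        simp only [pullbackProd_update, Pi.add_apply, add_mul]
      map_update_smul' := by
        intro _ m i c x
        rw [h.integral_congr (coeFn_update_ae m i (c • x) (Lp.coeFn_smul c x)),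
          h.integral_congr (coeFn_update_ae m i x .rfl), smul_eq_mul, ← integral_const_mul]
        simp only [pullbackProd_update, Pi.smul_apply, smul_eq_mul, mul_assoc] }
    1 fun F => by
      rw [one_mul]
      exact h.abs_integral_le fun i => Lp.memLp (F i)

theorem IsHolderFamily.form_apply {p : ENNReal} [Fact (1 ≤ p)] (h : IsHolderFamily π P μ p)
    (F : ι → Lp ℝ p μ) :
    h.form F = ∫ ω, pullbackProd π (fun i => (F i : Z → ℝ)) ω ∂P := rfl

theorem IsHolderFamily.form_update [DecidableEq ι] {p : ENNReal} [Fact (1 ≤ p)]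
    (h : IsHolderFamily π P μ p) (F : ι → Lp ℝ p μ) (i : ι) (H : Lp ℝ p μ) :
    h.form (Function.update F i H) =
      ∫ ω, pullbackProd π (Function.update (fun j => (F j : Z → ℝ)) i H) ω ∂P :=
  h.integral_congr (coeFn_update_ae F i H .rfl)

end PullbackProduct

/-! ### Calculus of variations and changes of variables -/

/-- The directional derivative of the homogeneous polynomial of a multilinear form. -/
theorem ContinuousMultilinearMap.hasDerivAt_diag {ι E : Type*} [Fintype ι] [DecidableEq ι]
    [NormedAddCommGroup E] [NormedSpace ℝ E]
    (M : ContinuousMultilinearMap ℝ (fun _ : ι => E) ℝ) (F H : E) :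
    HasDerivAt (fun s : ℝ => M fun _ => F + s • H)
      (∑ i, M (Function.update (fun _ => F) i H)) 0 := by
  have h1 := M.hasFDerivAt (x := fun _ => F + (0 : ℝ) • H)
  have h2 : HasDerivAt (fun s : ℝ => (fun _ : ι => F + s • H)) (fun _ => H) 0 := by
    refine hasDerivAt_pi.2 fun i => ?_
    simpa using ((hasDerivAt_id (0 : ℝ)).smul_const H).const_add F
  have h3 : HasDerivAt (fun s : ℝ => M fun _ => F + s • H) _ 0 := h1.comp_hasDerivAt (0 : ℝ) h2
  simpa only [ContinuousMultilinearMap.linearDeriv_apply, zero_smul, add_zero] using h3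

/-- A continuous function that is bounded below and uniformly convex attains its minimum. -/
theorem exists_forall_le_of_uniformlyConvex {E : Type*} [NormedAddCommGroup E] [NormedSpace ℝ E]
    [CompleteSpace E] {Φ : E → ℝ} (hΦ : Continuous Φ) (hb : BddBelow (Set.range Φ)) {c : ℝ}
    (hc : 0 < c) {n : ℕ}
    (h : ∀ F G, c * ‖F - G‖ ^ n ≤ Φ F + Φ G - 2 * Φ ((1 / 2 : ℝ) • (F + G))) :
    ∃ F, ∀ G, Φ F ≤ Φ G := by
  set m := ⨅ F, Φ F with hm
  have hle : ∀ F, m ≤ Φ F := fun F => ciInf_le hb F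
  have hex : ∀ j : ℕ, ∃ F, Φ F < m + 1 / ((j : ℝ) + 1) := fun j =>
    exists_lt_of_ciInf_lt (lt_add_of_pos_right _ (by positivity))
  choose u hu using hex
  have hu0 : Filter.Tendsto (fun j : ℕ => Φ (u j)) Filter.atTop (nhds m) := by
    refine tendsto_of_tendsto_of_tendsto_of_le_of_le tendsto_const_nhds ?_ (fun j => hle _)
      fun j => (hu j).le
    simpa using tendsto_one_div_add_atTop_nhds_zero_nat.const_add m
  have hcauchy : CauchySeq u := by
    rw [Metric.cauchySeq_iff]
    intro ε hε
    have hlt : ∀ᶠ j in Filter.atTop, Φ (u j) < m + c * ε ^ n / 2 :=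
      hu0.eventually (gt_mem_nhds (lt_add_of_pos_right _ (by positivity)))
    obtain ⟨N, hN⟩ := Filter.eventually_atTop.1 hlt
    refine ⟨N, fun a ha b hb' => ?_⟩
    rw [dist_eq_norm]
    have h1 := h (u a) (u b)
    -- The midpoint cannot go below the infimum, so two near-minimisers must be close.
    have h2 := hle ((1 / 2 : ℝ) • (u a + u b))
    have h3 := hN a ha
    have h4 := hN b hb'
    have h5 : c * ‖u a - u b‖ ^ n < c * ε ^ n := by linarith
    exact lt_of_pow_lt_pow_left₀ n hε.le (lt_of_mul_lt_mul_left h5 hc.le)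
  obtain ⟨F, hF⟩ := cauchySeq_tendsto_of_complete hcauchy
  refine ⟨F, fun G => ?_⟩
  rw [tendsto_nhds_unique ((hΦ.tendsto F).comp hF) hu0]
  exact hle G


theorem MeasureTheory.MeasurePreserving.lintegral_comp_of_aemeasurable {α β : Type*}
    [MeasurableSpace α] [MeasurableSpace β] {μ : Measure α} {ν : Measure β} {g : α → β}
    (hg : MeasurePreserving g μ ν) {f : β → ENNReal} (hf : AEMeasurable f ν) :
    ∫⁻ a, f (g a) ∂μ = ∫⁻ b, f b ∂ν := by
  rw [← lintegral_map' (hg.map_eq ▸ hf) hg.measurable.aemeasurable, hg.map_eq]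

theorem MeasureTheory.MeasurePreserving.integral_comp_of_aestronglyMeasurable {α β : Type*}
    [MeasurableSpace α] [MeasurableSpace β] {μ : Measure α} {ν : Measure β} {g : α → β}
    (hg : MeasurePreserving g μ ν) {f : β → ℝ} (hf : AEStronglyMeasurable f ν) :
    ∫ a, f (g a) ∂μ = ∫ b, f b ∂ν := by
  rw [← integral_map hg.measurable.aemeasurable (hg.map_eq ▸ hf), hg.map_eq]

/-! ### Geometry of parallelepipeds and Hölder's inequality on them -/

section Cube

variable {Z : Type*} [AddCommGroup Z]

theorem cubeDot_insertNth {n : ℕ} (i : Fin (n + 1)) (b : Fin 2) (ε : Fin n → Fin 2)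
    (t : Fin (n + 1) → Z) :
    cubeDot (i.insertNth b ε) t = (b : ℕ) • t i + cubeDot ε (fun j => t (i.succAbove j)) := by
  simp [cubeDot, Fin.sum_univ_succAbove _ i]

/-- Evaluation at the vertex `ε` of a parallelepiped. -/
def cubeVertex {d : ℕ} (ε : Fin d → Fin 2) (p : Z × (Fin d → Z)) : Z := p.1 + cubeDot ε p.2

/-- Restriction of a cube-indexed family to the face `ε i = b`. -/
def cubeFace {α : Type*} {n : ℕ} (i : Fin (n + 1)) (b : Fin 2) (u : (Fin (n + 1) → Fin 2) → α) :
    (Fin n → Fin 2) → α := fun ε => u (i.insertNth b ε)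

theorem prod_cube_succAbove {M : Type*} [CommMonoid M] {n : ℕ} (i : Fin (n + 1))
    (φ : (Fin (n + 1) → Fin 2) → M) :
    ∏ ε, φ ε = (∏ ε, φ (i.insertNth 0 ε)) * ∏ ε, φ (i.insertNth 1 ε) := by
  rw [← (Fin.insertNthEquiv (fun _ => Fin 2) i).prod_comp, Fintype.prod_prod_type,
    Fin.prod_univ_two]
  rfl

/-- A parallelepiped, seen as two parallel opposite faces in direction `i`. -/
def splitCube {n : ℕ} (i : Fin (n + 1)) (p : Z × (Fin (n + 1) → Z)) : (Z × Z) × (Fin n → Z) :=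
  ((p.1, p.1 + p.2 i), fun j => p.2 (i.succAbove j))

theorem prod_cube_splitCube {M : Type*} [CommMonoid M] {n : ℕ} (i : Fin (n + 1))
    (u : (Fin (n + 1) → Fin 2) → Z → M) (p : Z × (Fin (n + 1) → Z)) :
    ∏ ε, u ε (cubeVertex ε p) =
      (∏ ε, cubeFace i 0 u ε (cubeVertex ε ((splitCube i p).1.1, (splitCube i p).2))) *
        ∏ ε, cubeFace i 1 u ε (cubeVertex ε ((splitCube i p).1.2, (splitCube i p).2)) := by
  rw [prod_cube_succAbove i]
  simp [cubeVertex, cubeFace, splitCube, cubeDot_insertNth, add_assoc]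

variable [MeasurableSpace Z] [MeasurableAdd₂ Z]

theorem measurable_cubeDot {d : ℕ} (ε : Fin d → Fin 2) :
    Measurable (fun t : Fin d → Z => cubeDot ε t) := by
  unfold cubeDot
  refine Finset.measurable_fun_sum _ fun i _ => ?_
  generalize ε i = b
  fin_cases b
  · simp
  · simpa using measurable_pi_apply i

theorem measurable_cubeVertex {d : ℕ} (ε : Fin d → Fin 2) :
    Measurable (cubeVertex ε : Z × (Fin d → Z) → Z) :=
  measurable_fst.add ((measurable_cubeDot ε).comp measurable_snd)

variable (μ : Measure Z) [IsProbabilityMeasure μ] [μ.IsAddLeftInvariant]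

/-- The measure on parallelepipeds of dimension `d`. -/
abbrev cubeMeasure (d : ℕ) : Measure (Z × (Fin d → Z)) := μ.prod (Measure.pi fun _ : Fin d => μ)

/-- For each fixed parameter the map is a translation, so this is a skew product over `T` followed
by a projection. -/
theorem measurePreserving_add_right_fst {T : Type*} [MeasurableSpace T] (ν : Measure T)
    [IsProbabilityMeasure ν] {c : T → Z} (hc : Measurable c) :
    MeasurePreserving (fun p : Z × T => p.1 + c p.2) (μ.prod ν) μ := by
  have h1 : MeasurePreserving (fun q : T × Z => (q.1, c q.1 + q.2)) (ν.prod μ) (ν.prod μ) :=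
    (MeasurePreserving.id ν).skew_product (g := fun a x => c a + x)
      ((hc.comp measurable_fst).add measurable_snd)
      (Filter.Eventually.of_forall fun a => map_add_left_eq_self μ (c a))
  have h2 := (measurePreserving_snd (μ := ν) (ν := μ)).comp
    (h1.comp (Measure.measurePreserving_swap (μ := μ) (ν := ν)))
  convert h2 using 1
  ext p
  simp [add_comm]

theorem measurePreserving_cubeVertex {d : ℕ} (ε : Fin d → Fin 2) :
    MeasurePreserving (cubeVertex ε) (cubeMeasure μ d) μ :=
  measurePreserving_add_right_fst μ _ (measurable_cubeDot ε)

theorem measurePreserving_splitCube {n : ℕ} (i : Fin (n + 1)) :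
    MeasurePreserving (splitCube i) (cubeMeasure μ (n + 1))
      ((μ.prod μ).prod (Measure.pi fun _ : Fin n => μ)) := by
  have h1 := (MeasurePreserving.id μ).prod (measurePreserving_piFinSuccAbove (fun _ => μ) i)
  have h2 := (measurePreserving_prodAssoc μ μ (Measure.pi fun _ : Fin n => μ)).symm
  have h3 := (measurePreserving_prod_add μ μ).prod
    (MeasurePreserving.id (Measure.pi fun _ : Fin n => μ))
  exact h3.comp (h2.comp h1)

-- Translating both base points by ε · t preserves μ × μ, so the two vertices are independent; this
-- is the translation lemma for the group `Z × Z`.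
open ENNReal in
theorem lintegral_cubeVertex_mul_cubeVertex {n : ℕ} {a b : Z → ℝ≥0∞} (ha : AEMeasurable a μ)
    (hb : AEMeasurable b μ) (ε : Fin n → Fin 2) :
    ∫⁻ q, a (cubeVertex ε (q.1.1, q.2)) * b (cubeVertex ε (q.1.2, q.2))
      ∂((μ.prod μ).prod (Measure.pi fun _ : Fin n => μ)) = (∫⁻ x, a x ∂μ) * ∫⁻ x, b x ∂μ := by
  have : MeasurableAdd₂ (Z × Z) :=
    ⟨((measurable_fst.comp measurable_fst).add (measurable_fst.comp measurable_snd)).prodMk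
      ((measurable_snd.comp measurable_fst).add (measurable_snd.comp measurable_snd))⟩
  have hmp : MeasurePreserving (fun q : (Z × Z) × (Fin n → Z) =>
      (cubeVertex ε (q.1.1, q.2), cubeVertex ε (q.1.2, q.2)))
      ((μ.prod μ).prod (Measure.pi fun _ : Fin n => μ)) (μ.prod μ) := by
    exact measurePreserving_add_right_fst (μ.prod μ) (Measure.pi fun _ : Fin n => μ)
      (c := fun t => (cubeDot ε t, cubeDot ε t))
      ((measurable_cubeDot ε).prodMk (measurable_cubeDot ε))
  rw [← lintegral_prod_mul ha hb]
  exact hmp.lintegral_comp_of_aemeasurable (f := fun z => a z.1 * b z.2)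
    ((ha.comp_quasiMeasurePreserving Measure.quasiMeasurePreserving_fst).mul
      (hb.comp_quasiMeasurePreserving Measure.quasiMeasurePreserving_snd))

-- Pair each vertex with its neighbour in direction 0 and apply Hölder to the 2^n pairs. The two
-- vertices of a pair are independent, which is why the exponent is 2^n and not 2^(n+1).
open ENNReal in
theorem lintegral_cube_le {n : ℕ} {u : (Fin (n + 1) → Fin 2) → Z → ℝ≥0∞}
    (hu : ∀ ε, AEMeasurable (u ε) μ) :
    ∫⁻ p, ∏ ε, u ε (cubeVertex ε p) ∂(cubeMeasure μ (n + 1)) ≤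
      ∏ ε, (∫⁻ x, u ε x ^ (2 ^ n : ℝ) ∂μ) ^ (1 / (2 ^ n : ℝ)) := by
  have h2 : (2 ^ n : ℝ) ≠ 0 := by positivity
  set ν := (μ.prod μ).prod (Measure.pi fun _ : Fin n => μ)
  let w : (Fin n → Fin 2) → (Z × Z) × (Fin n → Z) → ℝ≥0∞ := fun ε q =>
    cubeFace 0 0 u ε (cubeVertex ε (q.1.1, q.2)) ^ (2 ^ n : ℝ) *
      cubeFace 0 1 u ε (cubeVertex ε (q.1.2, q.2)) ^ (2 ^ n : ℝ)
  have hmp1 : ∀ ε : Fin n → Fin 2, Measure.QuasiMeasurePreserving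
      (fun q : (Z × Z) × (Fin n → Z) => cubeVertex ε (q.1.1, q.2)) ν μ := fun ε =>
    ((measurePreserving_cubeVertex μ ε).comp
      (measurePreserving_fst.prod (MeasurePreserving.id _))).quasiMeasurePreserving
  have hmp2 : ∀ ε : Fin n → Fin 2, Measure.QuasiMeasurePreserving
      (fun q : (Z × Z) × (Fin n → Z) => cubeVertex ε (q.1.2, q.2)) ν μ := fun ε =>
    ((measurePreserving_cubeVertex μ ε).comp
      (measurePreserving_snd.prod (MeasurePreserving.id _))).quasiMeasurePreserving
  have hw : ∀ ε, AEMeasurable (w ε) ν := fun ε =>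
    (((hu _).comp_quasiMeasurePreserving (hmp1 ε)).pow_const _).mul
      (((hu _).comp_quasiMeasurePreserving (hmp2 ε)).pow_const _)
  calc ∫⁻ p, ∏ ε, u ε (cubeVertex ε p) ∂(cubeMeasure μ (n + 1))
      = ∫⁻ p, ∏ ε, w ε (splitCube 0 p) ^ (1 / (2 ^ n : ℝ)) ∂(cubeMeasure μ (n + 1)) := by
        refine lintegral_congr fun p => ?_
        rw [prod_cube_splitCube 0, ← Finset.prod_mul_distrib]
        refine Finset.prod_congr rfl fun ε _ => ?_
        rw [ENNReal.mul_rpow_of_nonneg _ _ (by positivity), ← ENNReal.rpow_mul,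
          ← ENNReal.rpow_mul, mul_one_div_cancel h2, ENNReal.rpow_one, ENNReal.rpow_one]
    _ = ∫⁻ q, ∏ ε, w ε q ^ (1 / (2 ^ n : ℝ)) ∂ν := by
        refine (measurePreserving_splitCube μ (0 : Fin (n + 1))).lintegral_comp_of_aemeasurable
          (f := fun q => ∏ ε, w ε q ^ (1 / (2 ^ n : ℝ))) ?_
        exact Finset.aemeasurable_fun_prod _ fun ε _ => (hw ε).pow_const _
    _ ≤ ∏ ε, (∫⁻ q, w ε q ∂ν) ^ (1 / (2 ^ n : ℝ)) := by
        refine ENNReal.lintegral_prod_norm_pow_le _ (fun ε _ => hw ε) ?_ fun _ _ => by positivity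
        simp [h2]
    _ = _ := by
        rw [prod_cube_succAbove 0, ← Finset.prod_mul_distrib]
        refine Finset.prod_congr rfl fun ε _ => ?_
        rw [← ENNReal.mul_rpow_of_nonneg _ _ (by positivity)]
        congr 1
        exact lintegral_cubeVertex_mul_cubeVertex μ ((hu _).pow_const _) ((hu _).pow_const _) ε

theorem isHolderFamily_cubeVertex {n : ℕ} {p : ENNReal} (hp : (2 : ENNReal) ^ n ≤ p) :
    IsHolderFamily (cubeVertex : (Fin (n + 1) → Fin 2) → Z × (Fin (n + 1) → Z) → Z)
      (cubeMeasure μ (n + 1)) μ p where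
  measurePreserving := measurePreserving_cubeVertex μ
  lintegral_le u hu := by
    have h1 := lintegral_cube_le μ (u := fun ε x => ‖u ε x‖ₑ) fun ε => (hu ε).enorm
    calc _ = ∫⁻ p, ∏ ε, ‖u ε (cubeVertex ε p)‖ₑ ∂(cubeMeasure μ (n + 1)) := by
          refine lintegral_congr fun p => ?_
          simp only [pullbackProd, enorm_eq_nnnorm, nnnorm_prod, ENNReal.ofNNReal_finsetProd]
      _ ≤ _ := h1
      _ ≤ _ := by
          refine Finset.prod_le_prod' fun ε _ => ?_
          refine le_trans (le_of_eq ?_) (eLpNorm_le_eLpNorm_of_exponent_le hp (hu ε))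
          rw [eLpNorm_eq_lintegral_rpow_enorm_toReal (by simp) (by simp)]
          simp

end Cube

/-! ### The Gowers inner product and the Cauchy-Schwarz-Gowers inequality -/

section CubeForm

variable {Z : Type*} [AddCommGroup Z] [MeasurableSpace Z]
  (μ : Measure Z)

/-- The Gowers inner product of a family of functions indexed by the vertices of the cube. -/
def cubeForm {d : ℕ} (u : (Fin d → Fin 2) → Z → ℝ) : ℝ :=
  ∫ p, pullbackProd cubeVertex u p ∂(cubeMeasure μ d)

/-- The partial integral of the Gowers product in the base point. -/
def cubePartial {d : ℕ} (u : (Fin d → Fin 2) → Z → ℝ) (t : Fin d → Z) : ℝ :=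
  ∫ x, ∏ ε, u ε (cubeVertex ε (x, t)) ∂μ

variable [MeasurableAdd₂ Z] [IsProbabilityMeasure μ] [μ.IsAddLeftInvariant]

variable {μ} in
theorem integrable_faces {n : ℕ} {p : ENNReal} (hp : (2 : ENNReal) ^ n ≤ p)
    {u : (Fin (n + 1) → Fin 2) → Z → ℝ} (hu : ∀ ε, MemLp (u ε) p μ) (i : Fin (n + 1)) :
    Integrable (fun q : (Z × Z) × (Fin n → Z) =>
      (∏ ε, cubeFace i 0 u ε (cubeVertex ε (q.1.1, q.2))) *
        ∏ ε, cubeFace i 1 u ε (cubeVertex ε (q.1.2, q.2)))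
      ((μ.prod μ).prod (Measure.pi fun _ : Fin n => μ)) := by
  have h1 := (isHolderFamily_cubeVertex μ hp).integrable hu
  refine ((measurePreserving_splitCube μ i).integrable_comp ?_).1 ?_
  · refine AEStronglyMeasurable.mul ?_ ?_
    · refine Finset.aestronglyMeasurable_fun_prod _ fun ε _ => ?_
      exact (hu _).aestronglyMeasurable.comp_measurePreserving
        ((measurePreserving_cubeVertex μ ε).comp
          (measurePreserving_fst.prod (MeasurePreserving.id _)))
    · refine Finset.aestronglyMeasurable_fun_prod _ fun ε _ => ?_
      exact (hu _).aestronglyMeasurable.comp_measurePreserving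
        ((measurePreserving_cubeVertex μ ε).comp
          (measurePreserving_snd.prod (MeasurePreserving.id _)))
  · refine h1.congr (Filter.Eventually.of_forall fun q => ?_)
    exact prod_cube_splitCube i u q

variable {μ} in
theorem integrable_cubePartial_mul {n : ℕ} {p : ENNReal} (hp : (2 : ENNReal) ^ n ≤ p)
    {u : (Fin (n + 1) → Fin 2) → Z → ℝ} (hu : ∀ ε, MemLp (u ε) p μ) (i : Fin (n + 1)) :
    Integrable (fun t => cubePartial μ (cubeFace i 0 u) t * cubePartial μ (cubeFace i 1 u) t)
      (Measure.pi fun _ : Fin n => μ) := by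
  refine (integrable_faces hp hu i).integral_prod_right.congr
    (Filter.Eventually.of_forall fun t => ?_)
  exact integral_prod_mul (fun x => ∏ ε, cubeFace i 0 u ε (cubeVertex ε (x, t)))
    fun y => ∏ ε, cubeFace i 1 u ε (cubeVertex ε (y, t))

-- The base points x and x + t_i of two opposite faces are independent, so Fubini factors the
-- integral for fixed remaining directions.
variable {μ} in
theorem cubeForm_eq_integral_cubePartial {n : ℕ} {p : ENNReal} (hp : (2 : ENNReal) ^ n ≤ p)
    {u : (Fin (n + 1) → Fin 2) → Z → ℝ} (hu : ∀ ε, MemLp (u ε) p μ) (i : Fin (n + 1)) :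
    cubeForm μ u = ∫ t, cubePartial μ (cubeFace i 0 u) t * cubePartial μ (cubeFace i 1 u) t
      ∂(Measure.pi fun _ : Fin n => μ) := by
  have hmp := measurePreserving_splitCube μ i
  have hK := integrable_faces hp hu i
  calc cubeForm μ u = ∫ q, (fun q : (Z × Z) × (Fin n → Z) =>
      (∏ ε, cubeFace i 0 u ε (cubeVertex ε (q.1.1, q.2))) *
        ∏ ε, cubeFace i 1 u ε (cubeVertex ε (q.1.2, q.2))) (splitCube i q)
        ∂(cubeMeasure μ (n + 1)) :=
        integral_congr_ae (Filter.Eventually.of_forall fun q => prod_cube_splitCube i u q)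
    _ = _ := by
        rw [hmp.integral_comp_of_aestronglyMeasurable hK.aestronglyMeasurable,
          integral_prod_symm _ hK]
        refine integral_congr_ae (Filter.Eventually.of_forall fun t => ?_)
        exact integral_prod_mul (fun x => ∏ ε, cubeFace i 0 u ε (cubeVertex ε (x, t)))
          fun y => ∏ ε, cubeFace i 1 u ε (cubeVertex ε (y, t))

theorem cubeFace_update {α : Type*} {n : ℕ} (i : Fin (n + 1)) (b c : Fin 2)
    (u : (Fin (n + 1) → Fin 2) → α) :
    cubeFace i c (fun ε => u (Function.update ε i b)) = cubeFace i b u := by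
  funext ε
  simp [cubeFace, Fin.update_insertNth]

theorem cubeFace_add_single {α : Type*} {n : ℕ} (i : Fin (n + 1)) (b c : Fin 2)
    (u : (Fin (n + 1) → Fin 2) → α) :
    cubeFace i c (fun ε => u (ε + Pi.single i b)) = cubeFace i (c + b) u := by
  funext ε
  refine congrArg u ?_
  ext j
  refine Fin.succAboveCases i ?_ (fun j => ?_) j <;> simp

variable {μ} in
/-- One step of the Cauchy-Schwarz-Gowers inequality, in arithmetic form. -/
theorem cubeForm_le_half_add {n : ℕ} {p : ENNReal} (hp : (2 : ENNReal) ^ n ≤ p)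
    {u : (Fin (n + 1) → Fin 2) → Z → ℝ} (hu : ∀ ε, MemLp (u ε) p μ) (i : Fin (n + 1)) :
    cubeForm μ u ≤ (1 / 2) * ∑ b, cubeForm μ (fun ε => u (Function.update ε i b)) := by
  have h0 : ∀ b, ∀ ε, MemLp (u (Function.update ε i b)) p μ := fun b ε => hu _
  rw [Fin.sum_univ_two, cubeForm_eq_integral_cubePartial hp hu i,
    cubeForm_eq_integral_cubePartial hp (h0 0) i, cubeForm_eq_integral_cubePartial hp (h0 1) i]
  have i0 := integrable_cubePartial_mul hp (h0 0) i
  have i1 := integrable_cubePartial_mul hp (h0 1) i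
  rw [← integral_add i0 i1, ← integral_const_mul]
  refine integral_mono (integrable_cubePartial_mul hp hu i) ((i0.add i1).const_mul _) fun t => ?_
  -- Each symmetrised family has equal opposite faces, so its integrand is a square and ab ≤ (a² +
  -- b²)/2 applies pointwise.
  simp only [cubeFace_update]
  nlinarith [sq_nonneg (cubePartial μ (cubeFace i 0 u) t - cubePartial μ (cubeFace i 1 u) t)]

variable {μ} in
theorem cubeForm_diag_nonneg {n : ℕ} {p : ENNReal} (hp : (2 : ENNReal) ^ n ≤ p)
    {f : Z → ℝ} (hf : MemLp f p μ) : 0 ≤ cubeForm μ (fun _ : Fin (n + 1) → Fin 2 => f) := by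
  rw [cubeForm_eq_integral_cubePartial hp (fun _ => hf) 0]
  exact integral_nonneg fun t => mul_self_nonneg _

-- A nonzero shift in direction i exchanges the two opposite faces, whose partial integrals commute.
variable {μ} in
theorem cubeForm_add_single {n : ℕ} {p : ENNReal} (hp : (2 : ENNReal) ^ n ≤ p)
    {u : (Fin (n + 1) → Fin 2) → Z → ℝ} (hu : ∀ ε, MemLp (u ε) p μ) (i : Fin (n + 1))
    (b : Fin 2) : cubeForm μ (fun ε => u (ε + Pi.single i b)) = cubeForm μ u := by
  rw [cubeForm_eq_integral_cubePartial hp (fun ε => hu _) i,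
    cubeForm_eq_integral_cubePartial hp hu i]
  refine integral_congr_ae (Filter.Eventually.of_forall fun t => ?_)
  simp only [cubeFace_add_single]
  fin_cases b
  · simp
  · exact mul_comm _ _

variable {μ} in
theorem cubeForm_add_right {n : ℕ} {p : ENNReal} (hp : (2 : ENNReal) ^ n ≤ p)
    (η : Fin (n + 1) → Fin 2) : ∀ {u : (Fin (n + 1) → Fin 2) → Z → ℝ},
    (∀ ε, MemLp (u ε) p μ) → cubeForm μ (fun ε => u (ε + η)) = cubeForm μ u := by
  refine Pi.single_induction (fun η => ∀ {u : (Fin (n + 1) → Fin 2) → Z → ℝ},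
    (∀ ε, MemLp (u ε) p μ) → cubeForm μ (fun ε => u (ε + η)) = cubeForm μ u) η ?_ ?_ ?_
  · intro u _
    simp
  · intro η₁ η₂ h1 h2 u hu
    rw [← h2 hu, ← h1 (u := fun ε => u (ε + η₂)) fun ε => hu _]
    simp only [add_assoc]
  · intro i b u hu
    exact cubeForm_add_single hp hu i b

theorem sum_cube_sum_update {n : ℕ} (i : Fin n) (φ : (Fin n → Fin 2) → ℝ) :
    ∑ η, ∑ b, φ (Function.update η i b) = 2 * ∑ η, φ η := by
  have h : ∀ η : Fin n → Fin 2, ∑ b, φ (Function.update η i b) =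
      φ η + φ (η + (Pi.single i 1 : Fin n → Fin 2)) := by
    intro η
    have h1 : φ η = φ (Function.update η i (η i)) := by rw [Function.update_eq_self]
    have h2 : η + Pi.single i 1 = Function.update η i (η i + 1) := by
      ext j
      rcases eq_or_ne j i with rfl | hj
      · simp
      · simp [hj]
    rw [h1, h2, Fin.sum_univ_two]
    generalize η i = c
    fin_cases c
    · rfl
    · exact add_comm _ _
  simp only [h, Finset.sum_add_distrib]
  rw [show ∑ η, φ (η + (Pi.single i 1 : Fin n → Fin 2)) = ∑ η, φ η from
    Equiv.sum_comp (Equiv.addRight (Pi.single i 1 : Fin n → Fin 2)) φ, two_mul]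

variable {μ} in
/-- The arithmetic form of the Cauchy-Schwarz-Gowers inequality. -/
theorem cubeForm_le_average {n : ℕ} {p : ENNReal} (hp : (2 : ENNReal) ^ n ≤ p)
    {u : (Fin (n + 1) → Fin 2) → Z → ℝ} (hu : ∀ ε, MemLp (u ε) p μ) :
    cubeForm μ u ≤ (1 / 2 ^ (n + 1)) * ∑ η, cubeForm μ (fun _ : Fin (n + 1) → Fin 2 => u η) := by
  -- The set `s` records the directions already symmetrised: empty, the average is trivial; full,
  -- every family is constant.
  have key : ∀ s : Finset (Fin (n + 1)), cubeForm μ u ≤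
      (1 / 2 ^ (n + 1)) * ∑ η, cubeForm μ (fun ε => u (s.piecewise η ε)) := by
    intro s
    induction s using Finset.induction_on with
    | empty => simp
    | insert i s hi ih =>
      refine ih.trans ?_
      refine mul_le_mul_of_nonneg_left ?_ (by positivity)
      have h1 : ∀ η, cubeForm μ (fun ε => u (s.piecewise η ε)) ≤ (1 / 2) *
          ∑ b, cubeForm μ (fun ε => u ((insert i s).piecewise (Function.update η i b) ε)) := by
        intro η
        refine (cubeForm_le_half_add hp (fun ε => hu _) i).trans_eq ?_
        congr 1
        refine Finset.sum_congr rfl fun b _ => ?_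
        congr 1
        ext1 ε
        congr 1
        ext j
        rcases eq_or_ne j i with rfl | hj
        · simp [hi]
        · by_cases hjs : j ∈ s <;> simp [hjs, hj]
      refine (Finset.sum_le_sum fun η _ => h1 η).trans_eq ?_
      rw [← Finset.mul_sum,
        sum_cube_sum_update i fun η => cubeForm μ (fun ε => u ((insert i s).piecewise η ε))]
      ring
  simpa using key Finset.univ

-- Translating the cube by -ε carries the distinguished vertex to 0. This symmetry makes all partial
-- derivatives of the Gowers form equal.
variable {μ} in
theorem cubeForm_update_eq {n : ℕ} {p : ENNReal} (hp : (2 : ENNReal) ^ n ≤ p)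
    {f h : Z → ℝ} (hf : MemLp f p μ) (hh : MemLp h p μ) (ε : Fin (n + 1) → Fin 2) :
    cubeForm μ (Function.update (fun _ => f) ε h) =
      cubeForm μ (Function.update (fun _ => f) (0 : Fin (n + 1) → Fin 2) h) := by
  have hu : ∀ η, MemLp (Function.update (fun _ : Fin (n + 1) → Fin 2 => f) 0 h η) p μ := by
    intro η
    rcases eq_or_ne η 0 with rfl | hη
    · simpa
    · simpa [Function.update_of_ne hη]
  rw [← cubeForm_add_right hp (-ε) hu]
  congr 1
  ext1 η
  rcases eq_or_ne η ε with rfl | hη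
  · simp
  · rw [Function.update_of_ne hη, Function.update_of_ne]
    rwa [← sub_eq_add_neg, sub_ne_zero]

variable {μ} in
/-- The tangent inequality for the convex function `f ↦ ‖f‖_{U(n+1)}^{2^{n+1}}`. -/
theorem cubeForm_update_le {n : ℕ} {p : ENNReal} (hp : (2 : ENNReal) ^ n ≤ p)
    {f h : Z → ℝ} (hf : MemLp f p μ) (hh : MemLp h p μ) :
    2 ^ (n + 1) * cubeForm μ (Function.update (fun _ => f) (0 : Fin (n + 1) → Fin 2) h) ≤
      cubeForm μ (fun _ : Fin (n + 1) → Fin 2 => h) +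
        (2 ^ (n + 1) - 1) * cubeForm μ (fun _ : Fin (n + 1) → Fin 2 => f) := by
  have hu : ∀ η, MemLp (Function.update (fun _ : Fin (n + 1) → Fin 2 => f) 0 h η) p μ := by
    intro η
    rcases eq_or_ne η 0 with rfl | hη
    · simpa
    · simpa [Function.update_of_ne hη]
  -- The family has one entry `h` and 2^(n+1) - 1 entries `f`, which gives the weights in the
  -- average.
  have h1 := cubeForm_le_average hp hu
  rw [← Finset.add_sum_erase _ _ (Finset.mem_univ 0), Finset.sum_congr rfl (g := fun _ =>
    cubeForm μ (fun _ : Fin (n + 1) → Fin 2 => f)) (fun η hη => by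
      rw [Function.update_of_ne (Finset.ne_of_mem_erase hη)])] at h1
  simp only [Function.update_self, Finset.sum_const, Finset.card_erase_of_mem (Finset.mem_univ _),
    Finset.card_univ, Fintype.card_fun, Fintype.card_fin, nsmul_eq_mul] at h1
  rw [Nat.cast_pred (by positivity)] at h1
  push_cast at h1
  rw [one_div, inv_mul_eq_div, le_div_iff₀ (by positivity)] at h1
  linarith

end CubeForm

/-! ### Conjugate dyadic exponents -/

section DyadicExponent

theorem one_le_two_pow_ennreal (k : ℕ) : (1 : ENNReal) ≤ 2 ^ k := one_le_pow₀ one_le_two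

theorem dyadicConj_inv_add (k : ℕ) : (dyadicConj k)⁻¹ + ((2 : ENNReal) ^ k)⁻¹ = 1 := by
  have h0 : (2 : ENNReal) ^ k ≠ 0 := by simp
  have ht : (2 : ENNReal) ^ k ≠ ⊤ := by simp
  unfold dyadicConj
  rw [ENNReal.inv_div (Or.inr ht) (Or.inr h0), ← one_div, ENNReal.div_add_div_same,
    tsub_add_cancel_of_le (one_le_two_pow_ennreal k), ENNReal.div_self h0 ht]

theorem holderConjugate_dyadicConj (k : ℕ) :
    ENNReal.HolderConjugate (dyadicConj k) ((2 : ENNReal) ^ k) :=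
  ENNReal.holderConjugate_iff.2 (dyadicConj_inv_add k)

theorem dyadicConj_anti {n k : ℕ} (h : n ≤ k) : dyadicConj k ≤ dyadicConj n := by
  rw [← ENNReal.inv_le_inv]
  have h1 := dyadicConj_inv_add n
  have h2 := dyadicConj_inv_add k
  have h3 : ((2 : ENNReal) ^ k)⁻¹ ≤ ((2 : ENNReal) ^ n)⁻¹ :=
    ENNReal.inv_le_inv.2 (pow_le_pow_right₀ one_le_two h)
  have h4 : ((2 : ENNReal) ^ n)⁻¹ ≠ ⊤ := by simp
  refine (ENNReal.add_le_add_iff_right h4).1 ?_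
  rw [h1, ← h2]
  exact add_le_add_right h3 _

/-- This identity places the power 2^k - 1 of an L^{2^k} function in the dual space. At k = 0 the
left side would be ∞ · 0 = 0. -/
theorem dyadicConj_mul {k : ℕ} (hk : 1 ≤ k) :
    dyadicConj k * ENNReal.ofReal ((2 ^ k - 1 : ℕ) : ℝ) = 2 ^ k := by
  have h1 : (1 : ℕ) < 2 ^ k := Nat.one_lt_two_pow (by omega)
  have h2 : ENNReal.ofReal ((2 ^ k - 1 : ℕ) : ℝ) = (2 : ENNReal) ^ k - 1 := by
    rw [ENNReal.ofReal_natCast]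
    push_cast
    rfl
  rw [h2, dyadicConj]
  refine ENNReal.div_mul_cancel ?_ (by simp)
  rw [← h2, Ne, ENNReal.ofReal_eq_zero, not_le]
  exact_mod_cast Nat.sub_pos_of_lt h1

end DyadicExponent

/-! ### The 2^k-th power of the L^{2^k} norm: multilinearity and Clarkson's inequality -/

section PowerForm

variable {Z : Type*} [MeasurableSpace Z] (μ : Measure Z)

open ENNReal in
theorem isHolderFamily_id (k : ℕ) :
    IsHolderFamily (fun (_ : Fin (2 ^ k)) (x : Z) => x) μ μ ((2 : ENNReal) ^ k) where
  measurePreserving _ := MeasurePreserving.id μ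
  lintegral_le u hu := by
    have h2 : (2 ^ k : ℝ) ≠ 0 := by positivity
    have h1 := ENNReal.lintegral_prod_norm_pow_le (μ := μ) (Finset.univ : Finset (Fin (2 ^ k)))
      (f := fun i x => ‖u i x‖ₑ ^ (2 ^ k : ℝ)) (fun i _ => (hu i).enorm.pow_const _)
      (p := fun _ => 1 / (2 ^ k : ℝ)) (by simp [h2]) (fun _ _ => by positivity)
    calc _ = ∫⁻ x, ∏ i, (‖u i x‖ₑ ^ (2 ^ k : ℝ)) ^ (1 / (2 ^ k : ℝ)) ∂μ := by
          refine lintegral_congr fun x => ?_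
          simp only [pullbackProd, ← ENNReal.rpow_mul, mul_one_div_cancel h2, ENNReal.rpow_one]
          simp only [enorm_eq_nnnorm, nnnorm_prod, ENNReal.ofNNReal_finsetProd]
      _ ≤ _ := h1
      _ = _ := by
          refine Finset.prod_congr rfl fun i _ => ?_
          rw [eLpNorm_eq_lintegral_rpow_enorm_toReal (by simp) (by simp)]
          simp

instance fact_one_le_two_pow (k : ℕ) : Fact ((1 : ENNReal) ≤ 2 ^ k) :=
  ⟨one_le_two_pow_ennreal k⟩

variable {μ}

theorem MeasureTheory.MemLp.integrable_two_pow {k : ℕ} {f : Z → ℝ}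
    (hf : MemLp f ((2 : ENNReal) ^ k) μ) : Integrable (fun x => f x ^ 2 ^ k) μ := by
  refine ((isHolderFamily_id μ k).integrable (u := fun _ => f) fun _ => hf).congr
    (Filter.Eventually.of_forall fun x => ?_)
  simp [pullbackProd]

theorem even_two_pow {k : ℕ} (hk : 1 ≤ k) : Even (2 ^ k) :=
  Nat.even_pow.2 ⟨even_two, by omega⟩

theorem MeasureTheory.Lp.norm_pow_two_pow {k : ℕ} (hk : 1 ≤ k) (F : Lp ℝ ((2 : ENNReal) ^ k) μ) :
    ‖F‖ ^ 2 ^ k = ∫ x, F x ^ 2 ^ k ∂μ := by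
  have h2 : (2 ^ k : ℝ) ≠ 0 := by positivity
  have h3 : 0 ≤ ∫ x, F x ^ 2 ^ k ∂μ := integral_nonneg fun x => (even_two_pow hk).pow_nonneg _
  have h1 : ‖F‖ = (∫ x, F x ^ 2 ^ k ∂μ) ^ ((2 ^ k : ℝ)⁻¹) := by
    rw [Lp.norm_def, (Lp.memLp F).eLpNorm_eq_integral_rpow_norm (by simp) (by simp),
      ENNReal.toReal_ofReal (by positivity)]
    congr 1
    · refine integral_congr_ae (Filter.Eventually.of_forall fun x => ?_)
      have : ((2 : ENNReal) ^ k).toReal = ((2 ^ k : ℕ) : ℝ) := by simp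
      simp only [this, Real.rpow_natCast, Real.norm_eq_abs, (even_two_pow hk).pow_abs]
  rw [h1, ← Real.rpow_natCast, ← Real.rpow_mul h3]
  push_cast
  rw [inv_mul_cancel₀ h2, Real.rpow_one]

/-- Write each power as a power of a square, use x^m + y^m ≤ (x + y)^m, the parallelogram identity,
and convexity of the m-th power, with m = 2^(k-1). -/
theorem clarkson_two_pow {k : ℕ} (hk : 1 ≤ k) (a b : ℝ) :
    ((1 / 2) * (a + b)) ^ 2 ^ k + ((1 / 2) * (a - b)) ^ 2 ^ k ≤
      (1 / 2) * (a ^ 2 ^ k + b ^ 2 ^ k) := by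
  obtain ⟨j, rfl⟩ : ∃ j, k = j + 1 := ⟨k - 1, by omega⟩
  have e : ∀ x : ℝ, x ^ 2 ^ (j + 1) = (x ^ 2) ^ 2 ^ j := fun x => by
    rw [pow_succ', pow_mul]
  simp only [e]
  have h1 := pow_add_pow_le (sq_nonneg ((1 / 2) * (a + b))) (sq_nonneg ((1 / 2) * (a - b)))
    (n := 2 ^ j) (by positivity)
  have h2 : ((1 / 2) * (a + b)) ^ 2 + ((1 / 2) * (a - b)) ^ 2 =
      (1 / 2) * a ^ 2 + (1 / 2) * b ^ 2 := by ring
  rw [h2] at h1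
  refine h1.trans ?_
  obtain ⟨_, hc⟩ := convexOn_pow (𝕜 := ℝ) (2 ^ j)
  have h3 := hc (Set.mem_Ici.2 (sq_nonneg a)) (Set.mem_Ici.2 (sq_nonneg b))
    (by norm_num : (0 : ℝ) ≤ 1 / 2) (by norm_num : (0 : ℝ) ≤ 1 / 2) (by norm_num)
  simp only [smul_eq_mul] at h3
  linarith

theorem MeasureTheory.Lp.clarkson_two_pow {k : ℕ} (hk : 1 ≤ k)
    (F G : Lp ℝ ((2 : ENNReal) ^ k) μ) :
    ‖(1 / 2 : ℝ) • (F + G)‖ ^ 2 ^ k + ‖(1 / 2 : ℝ) • (F - G)‖ ^ 2 ^ k ≤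
      (1 / 2) * (‖F‖ ^ 2 ^ k + ‖G‖ ^ 2 ^ k) := by
  simp only [Lp.norm_pow_two_pow hk]
  have hi : ∀ H : Lp ℝ ((2 : ENNReal) ^ k) μ, Integrable (fun x => H x ^ 2 ^ k) μ :=
    fun H => (Lp.memLp H).integrable_two_pow
  rw [← integral_add (hi _) (hi _), ← integral_add (hi _) (hi _), ← integral_const_mul]
  refine integral_mono_ae ((hi _).add (hi _)) (((hi _).add (hi _)).const_mul _) ?_
  filter_upwards [Lp.coeFn_smul (1 / 2 : ℝ) (F + G), Lp.coeFn_smul (1 / 2 : ℝ) (F - G),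
    Lp.coeFn_add F G, Lp.coeFn_sub F G] with x h1 h2 h3 h4
  rw [h1, h2]
  simp only [Pi.smul_apply, h3, h4, Pi.add_apply, Pi.sub_apply, smul_eq_mul]
  exact _root_.clarkson_two_pow hk _ _

/-- The continuous multilinear form `(F i) ↦ ∫ ∏ i, F i` on `L^{2^k}`, with `2^k` arguments. -/
abbrev powerForm (μ : Measure Z) (k : ℕ) :
    ContinuousMultilinearMap ℝ (fun _ : Fin (2 ^ k) => Lp ℝ ((2 : ENNReal) ^ k) μ) ℝ :=
  (isHolderFamily_id μ k).form

theorem powerForm_diag {k : ℕ} (hk : 1 ≤ k) (F : Lp ℝ ((2 : ENNReal) ^ k) μ) :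
    powerForm μ k (fun _ => F) = ‖F‖ ^ 2 ^ k := by
  rw [Lp.norm_pow_two_pow hk, IsHolderFamily.form_apply]
  simp [pullbackProd]

theorem powerForm_update {k : ℕ} (F H : Lp ℝ ((2 : ENNReal) ^ k) μ) (i : Fin (2 ^ k)) :
    powerForm μ k (Function.update (fun _ => F) i H) = ∫ x, H x * F x ^ (2 ^ k - 1) ∂μ := by
  rw [IsHolderFamily.form_update]
  simp [pullbackProd_update]

end PowerForm

theorem eLpNorm_pow_two_pow_sub_one {Z : Type*} [MeasurableSpace Z] {μ : Measure Z} {k : ℕ}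
    (hk : 1 ≤ k) (f : Z → ℝ) :
    eLpNorm (fun x => f x ^ (2 ^ k - 1)) (dyadicConj k) μ =
      eLpNorm f ((2 : ENNReal) ^ k) μ ^ (2 ^ k - 1) := by
  have h1 : 0 < 2 ^ k - 1 := Nat.sub_pos_of_lt (Nat.one_lt_two_pow (by omega))
  rw [← dyadicConj_mul hk, ← ENNReal.rpow_natCast, ← eLpNorm_norm_rpow f (by exact_mod_cast h1),
    ← eLpNorm_norm (fun x => f x ^ (2 ^ k - 1))]
  simp only [norm_pow, Real.rpow_natCast]

theorem memLp_pow_two_pow_sub_one {Z : Type*} [MeasurableSpace Z] {μ : Measure Z} {k : ℕ}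
    (hk : 1 ≤ k) {f : Z → ℝ} (hf : MemLp f ((2 : ENNReal) ^ k) μ) :
    MemLp (fun x => f x ^ (2 ^ k - 1)) (dyadicConj k) μ := by
  refine ⟨hf.aestronglyMeasurable.pow _, ?_⟩
  rw [eLpNorm_pow_two_pow_sub_one hk]
  exact ENNReal.pow_lt_top hf.eLpNorm_lt_top

/-! ### Gowers norms and dual functions -/

section DualFunction

variable {Z : Type*} [AddCommGroup Z] [MeasurableSpace Z] {μ : Measure Z}

theorem gowersNorm_eq_cubeForm (d : ℕ) (f : Z → ℝ) :
    gowersNorm μ d f = (cubeForm μ fun _ : Fin d → Fin 2 => f) ^ (1 / (2 : ℝ) ^ d) := rfl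

theorem cubeForm_diag_const_mul (d : ℕ) (c : ℝ) (f : Z → ℝ) :
    cubeForm μ (fun _ : Fin d → Fin 2 => fun x => c * f x) =
      c ^ 2 ^ d * cubeForm μ fun _ : Fin d → Fin 2 => f := by
  unfold cubeForm
  rw [← integral_const_mul]
  simp [pullbackProd, Finset.prod_mul_distrib]

omit [MeasurableSpace Z] in
theorem cubeVertex_zero {d : ℕ} (p : Z × (Fin d → Z)) : cubeVertex 0 p = p.1 := by
  simp [cubeVertex, cubeDot]

variable [MeasurableAdd₂ Z] [IsProbabilityMeasure μ] [μ.IsAddLeftInvariant]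

theorem gowersNorm_const_mul {n : ℕ} {p : ENNReal} (hp : (2 : ENNReal) ^ n ≤ p) {f : Z → ℝ}
    (hf : MemLp f p μ) {c : ℝ} (hc : 0 ≤ c) :
    gowersNorm μ (n + 1) (fun x => c * f x) = c * gowersNorm μ (n + 1) f := by
  rw [gowersNorm_eq_cubeForm, gowersNorm_eq_cubeForm, cubeForm_diag_const_mul,
    Real.mul_rpow (by positivity) (cubeForm_diag_nonneg hp hf)]
  congr 1
  rw [← Real.rpow_natCast, ← Real.rpow_mul hc]
  simp

theorem gowersNorm_nonneg {n : ℕ} {p : ENNReal} (hp : (2 : ENNReal) ^ n ≤ p) {f : Z → ℝ}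
    (hf : MemLp f p μ) : 0 ≤ gowersNorm μ (n + 1) f :=
  Real.rpow_nonneg (cubeForm_diag_nonneg hp hf) _

theorem gowersNorm_pow {n : ℕ} {p : ENNReal} (hp : (2 : ENNReal) ^ n ≤ p) {f : Z → ℝ}
    (hf : MemLp f p μ) :
    gowersNorm μ (n + 1) f ^ 2 ^ (n + 1) = cubeForm μ fun _ : Fin (n + 1) → Fin 2 => f := by
  rw [gowersNorm_eq_cubeForm, ← Real.rpow_natCast, ← Real.rpow_mul (cubeForm_diag_nonneg hp hf)]
  simp

omit [AddCommGroup Z] [MeasurableAdd₂ Z] [IsProbabilityMeasure μ] [μ.IsAddLeftInvariant] in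
theorem memLp_update {ι : Type*} [DecidableEq ι] {p : ENNReal} {f h : Z → ℝ} (hf : MemLp f p μ)
    (hh : MemLp h p μ) (i j : ι) : MemLp (Function.update (fun _ => f) i h j) p μ := by
  rcases eq_or_ne j i with rfl | hj
  · simpa
  · simpa [Function.update_of_ne hj]

/-- The vertex 0 depends on x alone, so its factor comes out of the integral over t. -/
theorem cubeForm_update_zero {n : ℕ} {p : ENNReal} (hp : (2 : ENNReal) ^ n ≤ p) {f h : Z → ℝ}
    (hf : MemLp f p μ) (hh : MemLp h p μ) :
    cubeForm μ (Function.update (fun _ => f) (0 : Fin (n + 1) → Fin 2) h) =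
      ∫ x, h x * dualFunction μ (n + 1) f x ∂μ := by
  have hi := (isHolderFamily_cubeVertex μ hp).integrable
    (memLp_update hf hh (0 : Fin (n + 1) → Fin 2))
  unfold cubeForm
  rw [integral_prod _ hi]
  refine integral_congr_ae (Filter.Eventually.of_forall fun x => ?_)
  simp only [pullbackProd_update, cubeVertex_zero, dualFunction, integral_const_mul]
  rfl

theorem integrable_dualFunction {n : ℕ} {p : ENNReal} (hp : (2 : ENNReal) ^ n ≤ p) {f : Z → ℝ}
    (hf : MemLp f p μ) : Integrable (dualFunction μ (n + 1) f) μ := by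
  have hi := (isHolderFamily_cubeVertex μ hp).integrable
    (memLp_update hf (memLp_const (1 : ℝ)) (0 : Fin (n + 1) → Fin 2))
  refine hi.integral_prod_left.congr (Filter.Eventually.of_forall fun x => ?_)
  simp only [pullbackProd_update, dualFunction, one_mul]
  rfl

end DualFunction

/-! ### The variational problem and its Euler-Lagrange equation -/

section Variational

variable {Z : Type*} [AddCommGroup Z] [MeasurableSpace Z] [MeasurableAdd₂ Z] (μ : Measure Z)
  [IsProbabilityMeasure μ] [μ.IsAddLeftInvariant]

/-- The Gowers inner product as a continuous multilinear form on `L^{2^k}`. -/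
abbrev gowersForm {n k : ℕ} (hnk : n ≤ k) :
    ContinuousMultilinearMap ℝ
      (fun _ : Fin (n + 1) → Fin 2 => Lp ℝ ((2 : ENNReal) ^ k) μ) ℝ :=
  (isHolderFamily_cubeVertex μ (pow_le_pow_right₀ one_le_two hnk)).form

variable {μ} {n k : ℕ}

/-- Add the tangent inequalities at the midpoint m in the directions F and G; since F + G = 2m, the
linear terms recombine into the form at m. -/
theorem gowersForm_convex (hnk : n ≤ k) (F G : Lp ℝ ((2 : ENNReal) ^ k) μ) :
    2 * gowersForm μ hnk (fun _ => (1 / 2 : ℝ) • (F + G)) ≤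
      gowersForm μ hnk (fun _ => F) + gowersForm μ hnk (fun _ => G) := by
  have hp : (2 : ENNReal) ^ n ≤ 2 ^ k := pow_le_pow_right₀ one_le_two hnk
  set m := (1 / 2 : ℝ) • (F + G) with hm
  have h1 : ∀ H : Lp ℝ ((2 : ENNReal) ^ k) μ,
      2 ^ (n + 1) * gowersForm μ hnk (Function.update (fun _ => m) 0 H) ≤
      gowersForm μ hnk (fun _ => H) + (2 ^ (n + 1) - 1) * gowersForm μ hnk (fun _ => m) := by
    intro H
    rw [IsHolderFamily.form_update]
    exact cubeForm_update_le hp (Lp.memLp m) (Lp.memLp H)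
  have h2 : gowersForm μ hnk (Function.update (fun _ => m) 0 F) +
      gowersForm μ hnk (Function.update (fun _ => m) 0 G) = 2 * gowersForm μ hnk (fun _ => m) := by
    rw [← ContinuousMultilinearMap.map_update_add]
    have : F + G = (2 : ℝ) • m := by rw [hm, smul_smul]; norm_num
    rw [this, ContinuousMultilinearMap.map_update_smul, Function.update_eq_self, smul_eq_mul]
  have h3 := h1 F
  have h4 := h1 G
  have h5 := congrArg (fun x => (2 : ℝ) ^ (n + 1) * x) h2
  simp only [mul_add] at h5
  linarith

theorem sum_gowersForm_update (hnk : n ≤ k) (F H : Lp ℝ ((2 : ENNReal) ^ k) μ) :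
    ∑ ε, gowersForm μ hnk (Function.update (fun _ => F) ε H) =
      2 ^ (n + 1) * ∫ x, H x * dualFunction μ (n + 1) F x ∂μ := by
  have hp : (2 : ENNReal) ^ n ≤ 2 ^ k := pow_le_pow_right₀ one_le_two hnk
  have h1 : ∀ ε, gowersForm μ hnk (Function.update (fun _ => F) ε H) =
      ∫ x, H x * dualFunction μ (n + 1) F x ∂μ := by
    intro ε
    rw [IsHolderFamily.form_update, ← cubeForm_update_zero hp (Lp.memLp F) (Lp.memLp H)]
    exact cubeForm_update_eq hp (Lp.memLp F) (Lp.memLp H) ε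
  simp [h1]

/-- A function bounded by one on the unit ball of the Gowers norm is bounded by the norm. -/
theorem abs_integral_le_gowersNorm {p : ENNReal} (hp : (2 : ENNReal) ^ n ≤ p) {g : Z → ℝ}
    (hg : ∀ f, StronglyMeasurable f → MemLp f ((2 : ENNReal) ^ n) μ → gowersNorm μ (n + 1) f ≤ 1 →
      |∫ x, g x * f x ∂μ| ≤ 1) {f : Z → ℝ} (hfm : StronglyMeasurable f) (hf : MemLp f p μ) :
    |∫ x, g x * f x ∂μ| ≤ gowersNorm μ (n + 1) f := by
  by_contra! hlt
  set a := gowersNorm μ (n + 1) f with ha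
  set I := |∫ x, g x * f x ∂μ| with hI
  have ha0 : 0 ≤ a := gowersNorm_nonneg hp hf
  have hpos : 0 < (a + I) / 2 := by linarith
  -- Rescaling by a value strictly between `a` and `I` avoids dividing by `a`, which may vanish.
  set c := ((a + I) / 2)⁻¹ with hc
  have hc0 : 0 < c := inv_pos.2 hpos
  have h1 := hg (fun x => c * f x) (hfm.const_mul c) ((hf.const_mul c).mono_exponent hp) (by
    rw [gowersNorm_const_mul hp hf hc0.le, hc, inv_mul_le_iff₀ hpos, ← ha]
    linarith)
  have h2 : ∫ x, g x * (c * f x) ∂μ = c * ∫ x, g x * f x ∂μ := by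
    rw [← integral_const_mul]
    congr 1
    ext x
    ring
  rw [h2, abs_mul, abs_of_pos hc0, ← hI, hc, inv_mul_le_iff₀ hpos] at h1
  linarith

/-- The variational problem whose solution decomposes `g`. -/
theorem exists_decomposition (hnk : n ≤ k) (hk : 1 ≤ k) {g : Z → ℝ} (hgm : MemLp g (dyadicConj k) μ)
    (hg : ∀ f, StronglyMeasurable f → MemLp f ((2 : ENNReal) ^ n) μ → gowersNorm μ (n + 1) f ≤ 1 →
      |∫ x, g x * f x ∂μ| ≤ 1) {c : ℝ} (hc : 0 < c) :
    ∃ F : Lp ℝ ((2 : ENNReal) ^ k) μ,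
      (∀ᵐ x ∂μ, g x = dualFunction μ (n + 1) F x + c * F x ^ (2 ^ k - 1)) ∧
      gowersNorm μ (n + 1) F ^ 2 ^ (n + 1) + c * ‖F‖ ^ 2 ^ k ≤ gowersNorm μ (n + 1) F := by
  have hp : (2 : ENNReal) ^ n ≤ 2 ^ k := pow_le_pow_right₀ one_le_two hnk
  have hconj := holderConjugate_dyadicConj k
  have hfact : Fact (1 ≤ dyadicConj k) := ⟨hconj.one_le⟩
  let G : Lp ℝ ((2 : ENNReal) ^ k) μ →L[ℝ] ℝ :=
    (ContinuousLinearMap.mul ℝ ℝ).lpPairing μ (dyadicConj k) ((2 : ENNReal) ^ k) (hgm.toLp g)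
  have hG : ∀ F, G F = ∫ x, g x * F x ∂μ := by
    intro F
    refine (ContinuousLinearMap.lpPairing_eq_integral _ _ _).trans (integral_congr_ae ?_)
    filter_upwards [hgm.coeFn_toLp] with x hx
    simp [hx]
  set q : ℝ := 2 ^ (n + 1) with hq
  set P : ℝ := 2 ^ k with hP
  have hq0 : 0 < q := by positivity
  have hP0 : 0 < P := by positivity
  -- The weights 1/q and 1/P cancel the degrees of homogeneity upon differentiation.
  let Φ : Lp ℝ ((2 : ENNReal) ^ k) μ → ℝ := fun F =>
    1 / q * gowersForm μ hnk (fun _ => F) + c / P * powerForm μ k (fun _ => F) - G F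
  have hGN : ∀ F, gowersForm μ hnk (fun _ => F) = gowersNorm μ (n + 1) F ^ 2 ^ (n + 1) :=
    fun F => (gowersNorm_pow hp (Lp.memLp F)).symm
  have hGle : ∀ F, G F ≤ gowersNorm μ (n + 1) F := fun F => by
    rw [hG]
    exact (le_abs_self _).trans
      (abs_integral_le_gowersNorm hp hg (Lp.stronglyMeasurable F) (Lp.memLp F))
  have hcont : Continuous Φ := by
    refine ((continuous_const.mul ?_).add (continuous_const.mul ?_)).sub G.continuous
    · exact (gowersForm μ hnk).cont.comp (continuous_pi fun _ => continuous_id)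
    · exact (powerForm μ k).cont.comp (continuous_pi fun _ => continuous_id)
  have hbdd : BddBelow (Set.range Φ) := by
    refine ⟨-1, ?_⟩
    rintro _ ⟨F, rfl⟩
    have h1 : 0 ≤ c / P * powerForm μ k (fun _ => F) := by
      rw [powerForm_diag hk]
      positivity
    have h2 := hGle F
    -- Bernoulli's inequality gives a - 1 ≤ a^q / q, so the Gowers term absorbs the linear one up to
    -- the constant -1.
    have h3 := one_add_mul_le_pow (a := gowersNorm μ (n + 1) F - 1)
      (by linarith [gowersNorm_nonneg hp (Lp.memLp F)]) (2 ^ (n + 1))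
    have h4 : gowersNorm μ (n + 1) F - 1 ≤ 1 / q * gowersForm μ hnk (fun _ => F) := by
      rw [hGN, one_div, le_inv_mul_iff₀ hq0]
      rw [add_sub_cancel] at h3
      push_cast at h3
      linarith
    simp only [Φ]
    linarith
  -- Only the power term contributes uniform convexity: the Gowers term is convex and `G` is linear.
  have hconv : ∀ F F', c / P * 2 * (1 / 2) ^ 2 ^ k * ‖F - F'‖ ^ 2 ^ k ≤
      Φ F + Φ F' - 2 * Φ ((1 / 2 : ℝ) • (F + F')) := by
    intro F F'
    have h1 := gowersForm_convex hnk F F'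
    have h2 := Lp.clarkson_two_pow hk F F'
    have h3 : 2 * G ((1 / 2 : ℝ) • (F + F')) = G F + G F' := by
      rw [map_smul, map_add, smul_eq_mul]
      ring
    have h4 : ‖(1 / 2 : ℝ) • (F - F')‖ ^ 2 ^ k = (1 / 2) ^ 2 ^ k * ‖F - F'‖ ^ 2 ^ k := by
      rw [norm_smul, mul_pow]
      norm_num
    rw [h4] at h2
    have h5 := mul_le_mul_of_nonneg_left h1 (one_div_pos.2 hq0).le
    have h6 := mul_le_mul_of_nonneg_left h2 (by positivity : 0 ≤ 2 * (c / P))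
    simp only [Φ, powerForm_diag hk]
    linarith
  obtain ⟨F, hF⟩ := exists_forall_le_of_uniformlyConvex hcont hbdd (by positivity) hconv
  have hEL : ∀ H : Lp ℝ ((2 : ENNReal) ^ k) μ,
      ∫ x, H x * dualFunction μ (n + 1) F x ∂μ + c * ∫ x, H x * F x ^ (2 ^ k - 1) ∂μ = G H := by
    intro H
    have h1 : HasDerivAt (fun s : ℝ => Φ (F + s • H)) _ 0 :=
      ((((gowersForm μ hnk).hasDerivAt_diag F H).const_mul (1 / q)).add
        (((powerForm μ k).hasDerivAt_diag F H).const_mul (c / P))).sub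
        (G.hasFDerivAt.comp_hasDerivAt (0 : ℝ)
          (((hasDerivAt_id (0 : ℝ)).smul_const H).const_add F))
    have h2 : IsLocalMin (fun s : ℝ => Φ (F + s • H)) 0 :=
      Filter.Eventually.of_forall fun s => by simpa using hF (F + s • H)
    have h3 := h2.hasDerivAt_eq_zero h1
    rw [sum_gowersForm_update] at h3
    simp only [powerForm_update, Finset.sum_const, Finset.card_univ, Fintype.card_fin,
      nsmul_eq_mul, one_smul] at h3
    push_cast at h3
    rw [← hq, ← hP] at h3
    field_simp at h3
    linarith
  have hpow : Integrable (fun x => F x ^ (2 ^ k - 1)) μ :=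
    (memLp_pow_two_pow_sub_one hk (Lp.memLp F)).integrable hconj.one_le
  have hgi : Integrable g μ := hgm.integrable hconj.one_le
  have hDi := integrable_dualFunction hp (Lp.memLp F)
  refine ⟨F, ?_, ?_⟩
  · have hDp : Integrable (fun x => dualFunction μ (n + 1) F x + c * F x ^ (2 ^ k - 1)) μ :=
      hDi.add (hpow.const_mul c)
    refine Integrable.ae_eq_of_forall_setIntegral_eq _ _ hgi hDp fun S hS _ => ?_
    -- Indicators as directions of variation turn the weak equation into an almost everywhere
    -- identity.
    have hind : ∀ φ : Z → ℝ, ∫ x, (indicatorConstLp ((2 : ENNReal) ^ k) hS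
        (measure_ne_top μ S) (1 : ℝ)) x * φ x ∂μ = ∫ x in S, φ x ∂μ := by
      intro φ
      rw [← integral_indicator hS]
      refine integral_congr_ae ?_
      filter_upwards [indicatorConstLp_coeFn (p := (2 : ENNReal) ^ k) (hs := hS)
        (hμs := measure_ne_top μ S) (c := (1 : ℝ))] with x hx
      rw [hx]
      by_cases hxS : x ∈ S <;> simp [hxS]
    have h1 := hEL (indicatorConstLp ((2 : ENNReal) ^ k) hS (measure_ne_top μ S) (1 : ℝ))
    rw [hG] at h1
    simp only [mul_comm (g _)] at h1
    rw [hind, hind, hind] at h1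
    rw [← h1, integral_add hDi.integrableOn (hpow.const_mul c).integrableOn, integral_const_mul]
  -- The direction `F` itself gives the energy identity, whose right side `G F` is at most the
  -- Gowers norm.
  · have h1 := hEL F
    have h2 := hGle F
    have h3 : ∫ x, F x * F x ^ (2 ^ k - 1) ∂μ = ‖F‖ ^ 2 ^ k := by
      rw [Lp.norm_pow_two_pow hk]
      simp only [mul_pow_sub_one (pow_ne_zero k two_ne_zero)]
    have h4 := sum_gowersForm_update hnk F F
    simp only [Function.update_eq_self, Finset.sum_const, Finset.card_univ, Fintype.card_fun,
      Fintype.card_fin, nsmul_eq_mul] at h4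
    push_cast at h4
    have h5 := mul_left_cancel₀ hq0.ne' h4
    rw [← hGN, h5, ← h3]
    linarith

end Variational

/-! ### The decomposition when addition is jointly measurable -/

section DualDecomposition

variable {Z : Type*} [AddCommGroup Z] [MeasurableSpace Z] [MeasurableAdd₂ Z] {μ : Measure Z}
  [IsProbabilityMeasure μ] [μ.IsAddLeftInvariant]

theorem gowersNorm_one_eq {f : Z → ℝ} (hf : Integrable f μ) :
    gowersNorm μ 1 f = |∫ x, f x ∂μ| := by
  have hf' : MemLp f ((2 : ENNReal) ^ 0) μ := by simpa [memLp_one_iff_integrable] using hf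
  have h1 : cubeForm μ (fun _ : Fin (0 + 1) → Fin 2 => f) = (∫ x, f x ∂μ) ^ 2 := by
    rw [cubeForm_eq_integral_cubePartial le_rfl (fun _ => hf') 0]
    simp [cubePartial, cubeFace, cubeVertex, cubeDot, sq]
  rw [gowersNorm_eq_cubeForm, h1, pow_one, ← Real.sqrt_eq_rpow, Real.sqrt_sq_eq_abs]

omit [MeasurableAdd₂ Z] [μ.IsAddLeftInvariant] in
theorem dualFunction_one_const (a : ℝ) (x : Z) : dualFunction μ 1 (fun _ => a) x = a := by
  simp [dualFunction, Finset.card_erase_of_mem]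

/-- The U(1) norm is |∫ f|, so `g` annihilates mean-zero functions. Testing it on its own deviation
from the mean shows that the variance is zero. -/
theorem eq_const_of_abs_integral_le {g : Z → ℝ} (hgm : MemLp g (dyadicConj 0) μ)
    (hg : ∀ f, StronglyMeasurable f → MemLp f ((2 : ENNReal) ^ 0) μ → gowersNorm μ (0 + 1) f ≤ 1 →
      |∫ x, g x * f x ∂μ| ≤ 1) : ∃ c : ℝ, |c| ≤ 1 ∧ ∀ᵐ x ∂μ, g x = c := by
  have htop : dyadicConj 0 = ⊤ := by simp [dyadicConj]
  rw [htop] at hgm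
  have hgi : Integrable g μ := hgm.integrable le_top
  have hpair : ∀ f : Z → ℝ, StronglyMeasurable f → Integrable f μ →
      |∫ x, g x * f x ∂μ| ≤ |∫ x, f x ∂μ| := by
    intro f hfm hf
    rw [← gowersNorm_one_eq hf]
    exact abs_integral_le_gowersNorm (p := (2 : ENNReal) ^ 0) le_rfl hg hfm
      (by simpa [memLp_one_iff_integrable] using hf)
  set c := ∫ x, g x ∂μ with hc
  refine ⟨c, ?_, ?_⟩
  · simpa using hpair (fun _ => 1) stronglyMeasurable_const (integrable_const 1)
  · set g' := hgm.aestronglyMeasurable.mk g with hg'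
    have hgg' : g =ᵐ[μ] g' := hgm.aestronglyMeasurable.ae_eq_mk
    have hg'i : Integrable g' μ := hgi.congr hgg'
    have hi0 : ∫ x, (g' x - c) ∂μ = 0 := by
      rw [integral_sub hg'i (integrable_const c), ← integral_congr_ae hgg']
      simp [hc]
    have h1 := hpair (fun x => g' x - c)
      (hgm.aestronglyMeasurable.stronglyMeasurable_mk.sub stronglyMeasurable_const)
      (hg'i.sub (integrable_const c))
    rw [hi0, abs_zero, abs_nonpos_iff] at h1
    have hm : MemLp (fun x => g' x - c) ⊤ μ := (hgm.ae_eq hgg').sub (memLp_const c)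
    have hint1 : Integrable (fun x => g x * (g' x - c)) μ :=
      hgi.mul_of_top_left hm
    have hint2 : Integrable (fun x => c * (g' x - c)) μ :=
      (hg'i.sub (integrable_const c)).const_mul c
    have h2 : ∫ x, (g' x - c) ^ 2 ∂μ = 0 := by
      calc ∫ x, (g' x - c) ^ 2 ∂μ = ∫ x, (g x * (g' x - c) - c * (g' x - c)) ∂μ := by
            refine integral_congr_ae ?_
            filter_upwards [hgg'] with x hx
            rw [hx]
            ring
        _ = 0 := by
            rw [integral_sub hint1 hint2, h1, integral_const_mul, hi0]
            simp
    have hint3 : Integrable (fun x => (g' x - c) ^ 2) μ := by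
      refine (hint1.sub hint2).congr ?_
      filter_upwards [hgg'] with x hx
      simp only [Pi.sub_apply, hx]
      ring
    have h3 := (integral_eq_zero_iff_of_nonneg (fun x => sq_nonneg (g' x - c)) hint3).1 h2
    filter_upwards [h3, hgg'] with x hx hx'
    rw [hx']
    have : (g' x - c) ^ 2 = 0 := hx
    linarith [pow_eq_zero_iff (two_ne_zero) |>.1 this]

theorem exists_dual_decomposition_of_pos {n k : ℕ} (hnk : n ≤ k) (hk : 1 ≤ k) {g : Z → ℝ}
    (hgm : MemLp g (dyadicConj n) μ)
    (hg : ∀ f, StronglyMeasurable f → MemLp f ((2 : ENNReal) ^ n) μ → gowersNorm μ (n + 1) f ≤ 1 →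
      |∫ x, g x * f x ∂μ| ≤ 1) {δ : ℝ} (hδ : 0 < δ) :
    ∃ f : Z → ℝ, StronglyMeasurable f ∧ MemLp f ((2 : ENNReal) ^ k) μ ∧
      MemLp (fun x => g x - dualFunction μ (n + 1) f x) (dyadicConj k) μ ∧
      eLpNorm f ((2 : ENNReal) ^ k) μ ≤ ENNReal.ofReal (1 / δ) ∧
      eLpNorm (fun x => g x - dualFunction μ (n + 1) f x) (dyadicConj k) μ ≤ ENNReal.ofReal δ ∧
      gowersNorm μ (n + 1) f ≤ 1 := by
  -- With c = δ^(2^k) the energy bound involves only δ‖F‖, which then controls both `F` and the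
  -- remainder.
  obtain ⟨F, hF1, hF2⟩ := exists_decomposition hnk hk (hgm.mono_exponent (dyadicConj_anti hnk)) hg
    (c := δ ^ 2 ^ k) (by positivity)
  have hp : (2 : ENNReal) ^ n ≤ 2 ^ k := pow_le_pow_right₀ one_le_two hnk
  have ha0 : 0 ≤ gowersNorm μ (n + 1) F := gowersNorm_nonneg hp (Lp.memLp F)
  set a := gowersNorm μ (n + 1) F
  have hB0 : 0 ≤ ‖F‖ := norm_nonneg F
  have hFn : eLpNorm F ((2 : ENNReal) ^ k) μ = ENNReal.ofReal ‖F‖ := by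
    rw [Lp.norm_def, ENNReal.ofReal_toReal (Lp.eLpNorm_ne_top F)]
  set B := ‖F‖
  rw [← mul_pow] at hF2
  have hδB0 : 0 ≤ δ * B := by positivity
  have ha1 : a ≤ 1 := by
    by_contra! h
    have := lt_self_pow₀ h (Nat.one_lt_two_pow (n := n + 1) (by omega))
    linarith [pow_nonneg hδB0 (2 ^ k)]
  have hB1 : δ * B ≤ 1 := by
    refine (pow_le_one_iff_of_nonneg hδB0 (pow_ne_zero k two_ne_zero)).1 ?_
    linarith [pow_nonneg ha0 (2 ^ (n + 1))]
  have hh : (fun x => g x - dualFunction μ (n + 1) F x) =ᵐ[μ]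
      fun x => δ ^ 2 ^ k * F x ^ (2 ^ k - 1) := by
    filter_upwards [hF1] with x hx
    rw [hx]
    ring
  refine ⟨F, Lp.stronglyMeasurable F, Lp.memLp F, ?_, ?_, ?_, ha1⟩
  · exact (memLp_congr_ae hh).2 ((memLp_pow_two_pow_sub_one hk (Lp.memLp F)).const_mul _)
  · rw [hFn]
    refine ENNReal.ofReal_le_ofReal ?_
    rw [le_div_iff₀ hδ]
    linarith
  · rw [eLpNorm_congr_ae hh]
    have h1 := eLpNorm_const_smul (δ ^ 2 ^ k) (fun x => F x ^ (2 ^ k - 1)) (dyadicConj k) μ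
    rw [eLpNorm_pow_two_pow_sub_one hk, hFn, Real.enorm_of_nonneg (by positivity),
      ← ENNReal.ofReal_pow hB0, ← ENNReal.ofReal_mul (by positivity)] at h1
    refine h1.le.trans (ENNReal.ofReal_le_ofReal ?_)
    rw [← mul_pow_sub_one (pow_ne_zero k two_ne_zero) δ, mul_assoc, ← mul_pow]
    exact mul_le_of_le_one_right hδ.le (pow_le_one₀ hδB0 hB1)

theorem exists_dual_decomposition {n k : ℕ} (hnk : n ≤ k) {g : Z → ℝ}
    (hgm : MemLp g (dyadicConj n) μ)
    (hg : ∀ f, StronglyMeasurable f → MemLp f ((2 : ENNReal) ^ n) μ → gowersNorm μ (n + 1) f ≤ 1 →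
      |∫ x, g x * f x ∂μ| ≤ 1) {δ : ℝ} (hδ : 0 < δ) :
    ∃ f : Z → ℝ, StronglyMeasurable f ∧ MemLp f ((2 : ENNReal) ^ k) μ ∧
      MemLp (fun x => g x - dualFunction μ (n + 1) f x) (dyadicConj k) μ ∧
      eLpNorm f ((2 : ENNReal) ^ k) μ ≤ ENNReal.ofReal (1 / δ) ∧
      eLpNorm (fun x => g x - dualFunction μ (n + 1) f x) (dyadicConj k) μ ≤ ENNReal.ofReal δ ∧
      gowersNorm μ (n + 1) f ≤ 1 := by
  rcases Nat.eq_zero_or_pos k with rfl | hk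
  swap
  · exact exists_dual_decomposition_of_pos hnk hk hgm hg hδ
  obtain rfl : n = 0 := Nat.le_zero.1 hnk
  obtain ⟨c, hc1, hc⟩ := eq_const_of_abs_integral_le hgm hg
  -- A constant is its own dual function of level 1: it goes entirely into `f` if δ ≤ 1, and into
  -- the remainder otherwise.
  obtain ⟨a, ha1, ha2, ha3⟩ : ∃ a : ℝ, |a| ≤ 1 ∧ |a| ≤ 1 / δ ∧ |c - a| ≤ δ := by
    rcases le_total δ 1 with h | h
    · exact ⟨c, hc1, hc1.trans ((one_le_div hδ).2 h), by simpa using hδ.le⟩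
    · exact ⟨0, by simp, by simpa using hδ.le, by simpa using hc1.trans h⟩
  have hh : (fun x => g x - dualFunction μ (0 + 1) (fun _ => a) x) =ᵐ[μ] fun _ => c - a := by
    filter_upwards [hc] with x hx
    rw [dualFunction_one_const, hx]
  have hnorm : ∀ (b : ℝ) (p : ENNReal), p ≠ 0 →
      eLpNorm (fun _ : Z => b) p μ = ENNReal.ofReal |b| := by
    intro b p hp
    rw [eLpNorm_const b hp (IsProbabilityMeasure.ne_zero μ), measure_univ, ENNReal.one_rpow,
      mul_one, Real.enorm_eq_ofReal_abs]
  refine ⟨fun _ => a, stronglyMeasurable_const, memLp_const a,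
    (memLp_congr_ae hh).2 (memLp_const _), ?_, ?_, ?_⟩
  · rw [hnorm _ _ (by simp)]
    exact ENNReal.ofReal_le_ofReal ha2
  · rw [eLpNorm_congr_ae hh, hnorm _ _ (by simp [dyadicConj])]
    exact ENNReal.ofReal_le_ofReal ha3
  · rw [gowersNorm_one_eq (integrable_const a)]
    simpa using ha1

end DualDecomposition

/-! ### The Baire σ-algebra and transfer to it -/

section Baire

/-- A copy of `Z`, to be endowed with the Baire `σ`-algebra of `Z`. -/
def BaireCopy (Z : Type*) : Type _ := Z

variable {Z : Type*}

/-- The identity map from `Z` to its copy. -/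
def toBaire (x : Z) : BaireCopy Z := x

instance [AddCommGroup Z] : AddCommGroup (BaireCopy Z) := inferInstanceAs (AddCommGroup Z)

variable [TopologicalSpace Z]

/-- The Baire `σ`-algebra: the coarsest one for which all continuous real functions are
measurable. -/
instance : MeasurableSpace (BaireCopy Z) :=
  ⨆ φ : C(Z, ℝ), MeasurableSpace.comap (fun x : BaireCopy Z => φ x) inferInstance

theorem measurable_baire_of_continuous (φ : C(Z, ℝ)) :
    Measurable (fun x : BaireCopy Z => φ x) :=
  measurable_iff_comap_le.2
    (le_iSup (fun φ : C(Z, ℝ) => MeasurableSpace.comap (fun x : BaireCopy Z => φ x) inferInstance) φ)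

theorem measurable_to_baire {α : Type*} [MeasurableSpace α] {f : α → BaireCopy Z}
    (h : ∀ φ : C(Z, ℝ), Measurable fun a => φ (f a)) : Measurable f := by
  rw [measurable_iff_comap_le]
  change MeasurableSpace.comap f (⨆ φ : C(Z, ℝ),
    MeasurableSpace.comap (fun x : BaireCopy Z => φ x) inferInstance) ≤ _
  rw [MeasurableSpace.comap_iSup]
  refine iSup_le fun φ => ?_
  rw [MeasurableSpace.comap_comp]
  exact measurable_iff_comap_le.1 (h φ)

theorem measurable_toBaire [MeasurableSpace Z] [OpensMeasurableSpace Z] :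
    Measurable (toBaire : Z → BaireCopy Z) :=
  measurable_to_baire fun φ => φ.continuous.measurable

/-- The continuous functions on `Z × Z` that are measurable for the product of the Baire
`σ`-algebras. -/
def baireProdSubalgebra (Z : Type*) [TopologicalSpace Z] : Subalgebra ℝ C(Z × Z, ℝ) where
  carrier := {Ψ | Measurable fun p : BaireCopy Z × BaireCopy Z => Ψ (p.1, p.2)}
  mul_mem' h1 h2 := Measurable.mul h1 h2
  add_mem' h1 h2 := Measurable.add h1 h2
  algebraMap_mem' _ := measurable_const

/-- By Urysohn, functions of one coordinate separate points of `Z × Z`, so Stone-Weierstrass makes Ψ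
a uniform limit of product-measurable functions. Applied to φ(x + y), this makes addition
measurable. -/
theorem measurable_baire_prod_of_continuous [CompactSpace Z] [T2Space Z] (Ψ : C(Z × Z, ℝ)) :
    Measurable fun p : BaireCopy Z × BaireCopy Z => Ψ (p.1, p.2) := by
  have hsep : (baireProdSubalgebra Z).SeparatesPoints := by
    have hex : ∀ x y : Z, x ≠ y → ∃ φ : C(Z, ℝ), φ x ≠ φ y := by
      intro x y hxy
      obtain ⟨φ, h0, h1, _⟩ := exists_continuous_zero_one_of_isClosed (isClosed_singleton (x := x))
        (isClosed_singleton (x := y)) (by simpa using hxy)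
      refine ⟨φ, ?_⟩
      rw [h0 rfl, h1 rfl]
      simp
    intro p q hpq
    by_cases h : p.1 = q.1
    · have h2 : p.2 ≠ q.2 := fun h' => hpq (Prod.ext h h')
      obtain ⟨φ, hφ⟩ := hex _ _ h2
      exact ⟨_, ⟨φ.comp ⟨Prod.snd, continuous_snd⟩,
        (measurable_baire_of_continuous φ).comp measurable_snd, rfl⟩, hφ⟩
    · obtain ⟨φ, hφ⟩ := hex _ _ h
      exact ⟨_, ⟨φ.comp ⟨Prod.fst, continuous_fst⟩,
        (measurable_baire_of_continuous φ).comp measurable_fst, rfl⟩, hφ⟩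
  have htop := ContinuousMap.subalgebra_topologicalClosure_eq_top_of_separatesPoints _ hsep
  have hmem : Ψ ∈ closure (baireProdSubalgebra Z : Set C(Z × Z, ℝ)) := by
    rw [← Subalgebra.topologicalClosure_coe, htop]
    trivial
  obtain ⟨u, hu, hlim⟩ := mem_closure_iff_seq_limit.1 hmem
  refine measurable_of_tendsto_metrizable (f := fun j (p : BaireCopy Z × BaireCopy Z) =>
    u j (p.1, p.2)) hu (tendsto_pi_nhds.2 fun p => ?_)
  exact ((continuous_eval_const ((p.1, p.2) : Z × Z)).tendsto Ψ).comp hlim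

instance [AddCommGroup Z] [IsTopologicalAddGroup Z] [CompactSpace Z] [T2Space Z] :
    MeasurableAdd₂ (BaireCopy Z) where
  measurable_add := measurable_to_baire fun φ =>
    measurable_baire_prod_of_continuous
      (φ.comp ⟨fun p : Z × Z => p.1 + p.2, continuous_fst.add continuous_snd⟩)

variable [MeasurableSpace Z] [BorelSpace Z]

/-- An integrable function for a regular measure is almost everywhere equal to a Baire function. -/
theorem exists_measurable_baire_ae_eq [CompactSpace Z] [T2Space Z] {μ : Measure Z} [μ.Regular]
    {g : Z → ℝ} (hg : Integrable g μ) :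
    ∃ g' : BaireCopy Z → ℝ, Measurable g' ∧ g =ᵐ[μ] fun x => g' (toBaire x) := by
  have hex : ∀ j : ℕ, ∃ φ : Z → ℝ, eLpNorm (φ - g) 1 μ ≤ ((j : ENNReal) + 1)⁻¹ ∧
      Continuous φ := by
    intro j
    obtain ⟨φ, -, h1, h2, -⟩ :=
      (memLp_one_iff_integrable.2 hg).exists_hasCompactSupport_eLpNorm_sub_le
        ENNReal.one_ne_top (ε := ((j : ENNReal) + 1)⁻¹) (by simp [ENNReal.add_eq_top])
    exact ⟨φ, by rwa [eLpNorm_sub_comm], h2⟩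
  choose φ hφ hφc using hex
  have hlim : Filter.Tendsto (fun j => eLpNorm (φ j - g) 1 μ) Filter.atTop (nhds 0) := by
    refine tendsto_of_tendsto_of_tendsto_of_le_of_le tendsto_const_nhds ?_ (fun _ => zero_le) hφ
    have := (ENNReal.tendsto_inv_nat_nhds_zero).comp (Filter.tendsto_add_atTop_nat 1)
    refine this.congr fun j => ?_
    simp
  obtain ⟨ns, -, hns⟩ := (tendstoInMeasure_of_tendsto_eLpNorm one_ne_zero
    (fun j => (hφc j).aestronglyMeasurable) hg.aestronglyMeasurable hlim).exists_seq_tendsto_ae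
  -- The limsup is Baire measurable everywhere and equals the limit wherever the continuous
  -- approximants converge.
  refine ⟨fun x => Filter.limsup (fun j => φ (ns j) x) Filter.atTop,
    Measurable.limsup fun j => measurable_baire_of_continuous ⟨_, hφc (ns j)⟩, ?_⟩
  filter_upwards [hns] with x hx
  exact hx.limsup_eq.symm

theorem measurePreserving_toBaire (μ : Measure Z) :
    MeasurePreserving toBaire μ (μ.map toBaire) :=
  measurable_toBaire.measurePreserving μ

section Transfer

variable [AddCommGroup Z] (μ : Measure Z) [IsProbabilityMeasure μ]

instance : IsProbabilityMeasure (μ.map (toBaire : Z → BaireCopy Z)) :=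
  Measure.isProbabilityMeasure_map measurable_toBaire.aemeasurable

variable [IsTopologicalAddGroup Z] [CompactSpace Z] [T2Space Z]

instance [μ.IsAddLeftInvariant] :
    (μ.map (toBaire : Z → BaireCopy Z)).IsAddLeftInvariant where
  map_add_left_eq_self a := by
    rw [Measure.map_map (measurable_const_add a) measurable_toBaire]
    conv_rhs => rw [← map_add_left_eq_self μ a,
      Measure.map_map measurable_toBaire (continuous_const_add (M := Z) a).measurable]
    rfl

theorem gowersNorm_comp_toBaire (d : ℕ) {f : BaireCopy Z → ℝ} (hf : StronglyMeasurable f) :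
    gowersNorm μ d (fun x => f (toBaire x)) = gowersNorm (μ.map toBaire) d f := by
  have hmp := (measurePreserving_toBaire μ).prod
    (measurePreserving_pi (fun _ : Fin d => μ) (fun _ => μ.map toBaire)
      fun _ => measurePreserving_toBaire μ)
  have hm : StronglyMeasurable (pullbackProd (cubeVertex : (Fin d → Fin 2) → _) fun _ => f) :=
    Finset.stronglyMeasurable_fun_prod _ fun ε _ => hf.comp_measurable (measurable_cubeVertex ε)
  unfold gowersNorm
  congr 1
  exact hmp.integral_comp_of_aestronglyMeasurable hm.aestronglyMeasurable

theorem dualFunction_comp_toBaire (d : ℕ) {f : BaireCopy Z → ℝ} (hf : StronglyMeasurable f)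
    (x : Z) :
    dualFunction μ d (fun x => f (toBaire x)) x = dualFunction (μ.map toBaire) d f (toBaire x) := by
  have hmp := measurePreserving_pi (fun _ : Fin d => μ) (fun _ => μ.map toBaire)
    fun _ => measurePreserving_toBaire μ
  have hm : StronglyMeasurable fun t : Fin d → BaireCopy Z =>
      ∏ ε ∈ Finset.univ.erase (0 : Fin d → Fin 2), f (toBaire x + cubeDot ε t) :=
    Finset.stronglyMeasurable_fun_prod _ fun ε _ =>
      hf.comp_measurable ((measurable_cubeDot ε).const_add _)
  exact hmp.integral_comp_of_aestronglyMeasurable hm.aestronglyMeasurable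

end Transfer

end Baire
end

/-! ### The theorem for the Borel σ-algebra -/

theorem mainTheorem2 {Z : Type*} [AddCommGroup Z] [TopologicalSpace Z] [IsTopologicalAddGroup Z]
    [CompactSpace Z] [T2Space Z] [MeasurableSpace Z] [BorelSpace Z]
    (μ : Measure Z) [μ.IsAddHaarMeasure] [μ.Regular] [IsProbabilityMeasure μ]
    (d : ℕ) (hd : 1 ≤ d) (g : Z → ℝ) (hg : IsAntiUniform μ d g) (hg1 : antiUniformNorm μ d g = 1)
    (k : ℕ) (hk : d - 1 ≤ k) (δ : ℝ) (hδ : 0 < δ) :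
    ∃ f h : Z → ℝ,
      MemLp f ((2 : ENNReal) ^ k) μ ∧ MemLp h (dyadicConj k) μ ∧
      (∀ x, g x = dualFunction μ d f x + h x) ∧
      eLpNorm f ((2 : ENNReal) ^ k) μ ≤ ENNReal.ofReal (1 / δ) ∧
      eLpNorm h (dyadicConj k) μ ≤ ENNReal.ofReal δ ∧
      gowersNorm μ d f ≤ 1 := by
  obtain ⟨n, rfl⟩ : ∃ n, d = n + 1 := ⟨d - 1, by omega⟩
  rw [Nat.add_sub_cancel] at hk
  obtain ⟨hgm, hgb⟩ := hg
  rw [Nat.add_sub_cancel] at hgm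
  have hmp := measurePreserving_toBaire μ
  obtain ⟨g', hg'm, hgg'⟩ := exists_measurable_baire_ae_eq
    (hgm.integrable (holderConjugate_dyadicConj n).one_le)
  have hg'p : MemLp g' (dyadicConj n) (μ.map toBaire) :=
    (memLp_map_measure_iff hg'm.aestronglyMeasurable hmp.measurable.aemeasurable).2
      (hgm.ae_eq hgg')
  -- Strong measurability of the test functions, not just almost everywhere, is what lets Gowers
  -- norms transfer between the two σ-algebras.
  have hbound : ∀ f, StronglyMeasurable f → MemLp f ((2 : ENNReal) ^ n) (μ.map toBaire) →
      gowersNorm (μ.map toBaire) (n + 1) f ≤ 1 → |∫ x, g' x * f x ∂(μ.map toBaire)| ≤ 1 := by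
    intro f hfm hf hf1
    have hle : |∫ x, g x * f (toBaire x) ∂μ| ≤ antiUniformNorm μ (n + 1) g :=
      le_csSup hgb ⟨fun x => f (toBaire x), hf.comp_measurePreserving hmp,
        (gowersNorm_comp_toBaire μ (n + 1) hfm).trans_le hf1, rfl⟩
    rw [hg1] at hle
    rw [← hmp.integral_comp_of_aestronglyMeasurable (f := fun x => g' x * f x)
      (hg'm.stronglyMeasurable.mul hfm).aestronglyMeasurable]
    rwa [integral_congr_ae (g := fun x => g x * f (toBaire x))]
    filter_upwards [hgg'] with x hx
    simp [hx]
  obtain ⟨f, hfm, hf, hh, hfn, hhn, hf1⟩ := exists_dual_decomposition hk hg'p hbound hδ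
  have hae : (fun x => g x - dualFunction μ (n + 1) (fun x => f (toBaire x)) x) =ᵐ[μ]
      (fun y => g' y - dualFunction (μ.map toBaire) (n + 1) f y) ∘ toBaire := by
    filter_upwards [hgg'] with x hx
    simp only [Function.comp_apply, hx, dualFunction_comp_toBaire μ (n + 1) hfm x]
  -- Defining the remainder as a difference makes the decomposition hold at every point.
  refine ⟨fun x => f (toBaire x),
    fun x => g x - dualFunction μ (n + 1) (fun x => f (toBaire x)) x,
    hf.comp_measurePreserving hmp, (memLp_congr_ae hae).2 (hh.comp_measurePreserving hmp),
    fun x => by ring, ?_, ?_, ?_⟩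
  · exact (eLpNorm_comp_measurePreserving hf.aestronglyMeasurable hmp).trans_le hfn
  · rw [eLpNorm_congr_ae hae, eLpNorm_comp_measurePreserving hh.aestronglyMeasurable hmp]
    exact hhn
  · exact (gowersNorm_comp_toBaire μ (n + 1) hfm).trans_le hf1
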